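/- **Theorem 1.1 (composition with the small hypersphere).** Let $(M,g)$ be a compact connected smooth Riemannian manifold without boundary, let $n\ge 0$ be an integer and $r>0$. For $\rho>0$ let $\mathbb S^k(\rho)\subset\mathbb R^{k+1}$ be the sphere of radius $\rho$ centred at the origin, with the induced metric, and let $$\mathbf i:\mathbb S^n(r/\sqrt2)\to\mathbb S^{n+1}(r),\qquad \mathbf i(p)=(p,\,r/\sqrt2).$$ For a smooth map $\phi:M\to\mathbb S^k(\rho)$ write $e(\phi)=\tfrac12|d\phi|^2$ for its energy density and $\tau(\phi)=\operatorname{trace}\nabla^{\phi} d\phi$ for its tension field, where $\nabla^\phi$ is induced by the Levi-Civita connections of $M$ and $\mathbb S^k(\rho)$, and put $$E^1(\phi)=\int_M e(\phi)\,v_g,\qquad E^2(\phi)=\tfrac12\int_M|\tau(\phi)|^2\,v_g .$$ The map $\phi$ is called harmonic (respectively biharmonic) if it is a critical point of $E^1$ (respectively $E^2$), i.e. $\frac{d}{dt}\big|_{t=0}E^1(\phi_t)=0$ (respectively $\frac{d}{dt}\big|_{t=0}E^2(\phi_t)=0$) for every smooth one-parameter variation $\phi_t:M\to\mathbb S^k(\rho)$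 of $\phi_0=\phi$. Let $\psi:M\to\mathbb S^n(r/\sqrt2)$ be a nonconstant smooth map and $\phi=\mathbf i\circ\psi:M\to\mathbb S^{n+1}(r)$. Then $\phi$ is biharmonic and not harmonic if and only if $\psi$ is harmonic and its energy density $e(\psi)$ is constant on $M$. -/

import Mathlib

open scoped Manifold ContDiff
open MeasureTheory

noncomputable section

namespace SphereMaps

/-- The round sphere `Sⁿ(ρ)` of radius `ρ`, centred at the origin of `ℝⁿ⁺¹`. -/
abbrev Sph (n : ℕ) (ρ : ℝ) : Type :=
  Metric.sphere (0 : EuclideanSpace ℝ (Fin (n + 1))) ρ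

/-- The point `(x¹, …, xⁿ⁺¹, r/√2)` of `ℝⁿ⁺²`. -/
def appendHeight {n : ℕ} (r : ℝ) (p : EuclideanSpace ℝ (Fin (n + 1))) :
    EuclideanSpace ℝ (Fin (n + 1 + 1)) :=
  WithLp.toLp 2 (Fin.snoc (α := fun _ => ℝ) (fun j => p j) (r / √2))

theorem appendHeight_mem {n : ℕ} {r : ℝ} (hr : 0 < r) (p : Sph n (r / √2)) :
    appendHeight r (p : EuclideanSpace ℝ (Fin (n + 1))) ∈
      Metric.sphere (0 : EuclideanSpace ℝ (Fin (n + 1 + 1))) r := by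
  have hp : ‖(p : EuclideanSpace ℝ (Fin (n + 1)))‖ = r / √2 := by
    simp
  have h2 : (r / √2) ^ 2 = r ^ 2 / 2 := by
    rw [div_pow, Real.sq_sqrt (by norm_num)]
  have hs : ‖appendHeight r (p : EuclideanSpace ℝ (Fin (n + 1)))‖ ^ 2 = r ^ 2 := by
    have hp2 := congrArg (fun z : ℝ => z ^ 2) hp
    simp only [EuclideanSpace.norm_sq_eq, Real.norm_eq_abs, sq_abs] at hp2 ⊢
    rw [Fin.sum_univ_castSucc]
    simp only [appendHeight, Fin.snoc_castSucc, Fin.snoc_last]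
    rw [hp2, h2]
    ring
  rw [mem_sphere_zero_iff_norm]
  exact (pow_left_inj₀ (norm_nonneg _) hr.le (by norm_num)).1 hs

/-- The inclusion `i : Sⁿ(r/√2) → Sⁿ⁺¹(r)`, `p ↦ (p, r/√2)`, of the small hypersphere. -/
def smallInclusion (n : ℕ) {r : ℝ} (hr : 0 < r) (p : Sph n (r / √2)) : Sph (n + 1) r :=
  ⟨appendHeight r p, appendHeight_mem hr p⟩

section Manifold

variable {m : ℕ} {M : Type*} [TopologicalSpace M] [ChartedSpace (EuclideanSpace ℝ (Fin m)) M]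

section Smooth

variable (m)

/-- Smoothness of a map into a sphere, regarded as an embedded submanifold of Euclidean space. -/
def IsSmooth {N : ℕ} {ρ : ℝ} (φ : M → Sph N ρ) : Prop :=
  ContMDiff (𝓡 m) 𝓘(ℝ, EuclideanSpace ℝ (Fin (N + 1))) ∞
    (fun x => (φ x : EuclideanSpace ℝ (Fin (N + 1))))

/-- A smooth one-parameter variation `(φ_t)` of `φ`, through maps into the same sphere. -/
structure IsVariation {N : ℕ} {ρ : ℝ} (φ : M → Sph N ρ) (Φ : ℝ → M → Sph N ρ) : Prop where
  smooth : ContMDiff (𝓘(ℝ, ℝ).prod (𝓡 m)) 𝓘(ℝ, EuclideanSpace ℝ (Fin (N + 1))) ∞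
    (fun q : ℝ × M => (Φ q.1 q.2 : EuclideanSpace ℝ (Fin (N + 1))))
  at_zero : Φ 0 = φ

end Smooth

/-- The coordinate vector `∂ᵢ` of the chart around `c`, at the point with coordinates `y`. -/
def coordVec (c : M) (y : EuclideanSpace ℝ (Fin m)) (i : Fin m) :
    TangentSpace (𝓡 m) ((extChartAt (𝓡 m) c).symm y) :=
  mfderiv 𝓘(ℝ, EuclideanSpace ℝ (Fin m)) (𝓡 m) (extChartAt (𝓡 m) c).symm y
    (EuclideanSpace.single i (1 : ℝ))

/-- The partial derivative `∂ᵢf` on `ℝᵐ`. -/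
def partialD {F : Type*} [NormedAddCommGroup F] [NormedSpace ℝ F] (i : Fin m)
    (f : EuclideanSpace ℝ (Fin m) → F) (y : EuclideanSpace ℝ (Fin m)) : F :=
  fderiv ℝ f y (EuclideanSpace.single i (1 : ℝ))

/-- The map `φ` read in the chart around `c`, as a map into the Euclidean space that contains
the sphere. -/
def localRep {N : ℕ} {ρ : ℝ} (φ : M → Sph N ρ) (c : M) (y : EuclideanSpace ℝ (Fin m)) :
    EuclideanSpace ℝ (Fin (N + 1)) :=
  (φ ((extChartAt (𝓡 m) c).symm y) : EuclideanSpace ℝ (Fin (N + 1)))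

variable [IsManifold (𝓡 m) ∞ M]

/-- A smooth Riemannian metric on `M`. -/
abbrev Metr (m : ℕ) (M : Type*) [TopologicalSpace M]
    [ChartedSpace (EuclideanSpace ℝ (Fin m)) M] [IsManifold (𝓡 m) ∞ M] :=
  Bundle.ContMDiffRiemannianMetric (𝓡 m) ∞ (EuclideanSpace ℝ (Fin m))
    (fun x : M => TangentSpace (𝓡 m) x)

variable (g : Metr m M)

/-- The matrix `g_ij = g(∂ᵢ, ∂ⱼ)` in the chart around `c`, at coordinates `y`. -/
def gram (c : M) (y : EuclideanSpace ℝ (Fin m)) : Matrix (Fin m) (Fin m) ℝ :=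
  Matrix.of fun i j =>
    g.inner ((extChartAt (𝓡 m) c).symm y) (coordVec c y i) (coordVec c y j)

/-- The Christoffel symbol `Γᵏᵢⱼ = ½ gᵏˡ (∂ᵢ gⱼₗ + ∂ⱼ gᵢₗ - ∂ₗ gᵢⱼ)` of the Levi-Civita connection. -/
def christoffel (c : M) (y : EuclideanSpace ℝ (Fin m)) (k i j : Fin m) : ℝ :=
  (1 / 2) * ∑ l, (gram g c y)⁻¹ k l *
    (partialD i (fun z => gram g c z j l) y + partialD j (fun z => gram g c z i l) y
      - partialD l (fun z => gram g c z i j) y)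

/-- The energy density `e(φ) = ½ |dφ|² = ½ gⁱʲ ⟨∂ᵢφ, ∂ⱼφ⟩`. -/
def energyDensity {N : ℕ} {ρ : ℝ} (φ : M → Sph N ρ) (x : M) : ℝ :=
  let y := extChartAt (𝓡 m) x x
  (1 / 2) * ∑ i, ∑ j, (gram g x y)⁻¹ i j *
    inner ℝ (partialD i (localRep φ x) y) (partialD j (localRep φ x) y)

/-- The second fundamental form `∇dφ(∂ᵢ, ∂ⱼ) = ∇^φ_{∂ᵢ}(∂ⱼφ) - dφ(∇_{∂ᵢ}∂ⱼ)` in the chart around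
`c`, at coordinates `y`. The connection `∇^φ` of the pull-back bundle is induced by the Levi-Civita
connection of the sphere: it is the derivative in Euclidean space followed by the orthogonal
projection onto the tangent space `T_pS = p^⊥` of the sphere at `p = φ(x)`. -/
def secondFundForm {N : ℕ} {ρ : ℝ} (φ : M → Sph N ρ) (c : M)
    (y : EuclideanSpace ℝ (Fin m)) (i j : Fin m) : EuclideanSpace ℝ (Fin (N + 1)) :=
  (Submodule.span ℝ {localRep φ c y})ᗮ.starProjection
      (partialD i (partialD j (localRep φ c)) y)
    - ∑ k, christoffel g c y k i j • partialD k (localRep φ c) y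

/-- The tension field `τ(φ) = trace ∇dφ = gⁱʲ ∇dφ(∂ᵢ, ∂ⱼ)`. -/
def tension {N : ℕ} {ρ : ℝ} (φ : M → Sph N ρ) (x : M) : EuclideanSpace ℝ (Fin (N + 1)) :=
  let y := extChartAt (𝓡 m) x x
  ∑ i, ∑ j, (gram g x y)⁻¹ i j • secondFundForm g φ x y i j

section Volume

variable (m M) [T2Space M] [CompactSpace M]

/-- A smooth partition of unity on `M` subordinate to the domains of the preferred charts. -/
def chartPartition : SmoothPartitionOfUnity M (𝓡 m) M Set.univ :=
  (SmoothPartitionOfUnity.exists_isSubordinate_chartAt_source (𝓡 m) M).choose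

theorem chartPartition_isSubordinate : (chartPartition m M).IsSubordinate
    (fun x => (chartAt (EuclideanSpace ℝ (Fin m)) x).source) :=
  (SmoothPartitionOfUnity.exists_isSubordinate_chartAt_source (𝓡 m) M).choose_spec

variable {m M} [MeasurableSpace M]

/-- The Riemannian volume `v_g`: the measure with `∫ f v_g = ∑_c ∫ (χ_c f) √(det g_ij) dy`, for the
partition of unity `(χ_c)` above and integrals taken in the chart around `c`. -/
def vol : Measure M :=
  Measure.sum fun c : M =>
    ((volume.restrict (extChartAt (𝓡 m) c).target).withDensity fun y =>
      ENNReal.ofReal (chartPartition m M c ((extChartAt (𝓡 m) c).symm y) *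
        √(gram g c y).det)).map (extChartAt (𝓡 m) c).symm

/-- The energy `E¹(φ) = ½ ∫ |dφ|² v_g = ∫ e(φ) v_g`. -/
def energy {N : ℕ} {ρ : ℝ} (φ : M → Sph N ρ) : ℝ :=
  ∫ x, energyDensity g φ x ∂(vol g)

/-- The bienergy `E²(φ) = ½ ∫ |(d + d^*)²φ|² v_g = ½ ∫ |τ(φ)|² v_g`: here `(d + d^*)φ = dφ`, and
`(d + d^*)dφ = d^*dφ = -τ(φ)` because `∇dφ` is symmetric. -/
def bienergy {N : ℕ} {ρ : ℝ} (φ : M → Sph N ρ) : ℝ :=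
  (1 / 2) * ∫ x, ‖tension g φ x‖ ^ 2 ∂(vol g)

/-- Harmonic maps are the smooth critical points of the energy. -/
def IsHarmonic {N : ℕ} {ρ : ℝ} (φ : M → Sph N ρ) : Prop :=
  IsSmooth m φ ∧ ∀ Φ : ℝ → M → Sph N ρ, IsVariation m φ Φ →
    HasDerivAt (fun t => energy g (Φ t)) 0 0

/-- Biharmonic maps are the smooth critical points of the bienergy. -/
def IsBiharmonic {N : ℕ} {ρ : ℝ} (φ : M → Sph N ρ) : Prop :=
  IsSmooth m φ ∧ ∀ Φ : ℝ → M → Sph N ρ, IsVariation m φ Φ →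
    HasDerivAt (fun t => bienergy g (Φ t)) 0 0

end Volume

end Manifold

end SphereMaps

end

/-! Everything is computed with the ambient coordinates of sphere-valued maps. Write `u = |dφ|²`.
Differentiating `|φ|² = ρ²` twice gives `⟨φ, Δφ⟩ = -u`, so the tension field is `Δφ + (u/ρ²) φ`
(`tension_apply`) and `|τ|² = |Δφ|² - u²/ρ²` (`norm_tension_sq`). Since every tangent field `V`
along `φ` comes from a variation (`exists_isVariation`), biharmonicity is the weak equation `∫ ⟨Δφ,
ΔV⟩ - (2/ρ²) u ⟨dφ, dV⟩ = 0` for all tangent `V` (`isBiharmonic_iff`), and harmonicity is `Δφ =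
-(u/ρ²) φ` (`isHarmonic_iff`).

For `φ = (ψ, r/√2)` the last coordinate is constant and nonzero. It contributes nothing to the weak
equation, while the last component of `V` can always be chosen to restore tangency. The first
components `W` of `V` are therefore arbitrary, with no tangency condition
(`isBiharmonic_smallInclusion_comp_iff`). This freedom allows two test fields normal to the small
sphere. With `W = ψ` the integrand is `|Δψ + (2/r²) u ψ|²`, which makes `ψ` harmonic. With `W = u
ψ`, harmonicity and Green's formula reduce the equation to `∫ |du|² = 0`, so `u` is constant on the
connected manifold. Conversely, if `u = c` and `Δψ = -(2c/r²) ψ`, the weak equation is a multiple of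
Green's formula. Finally, harmonicity of `φ` would force `u = 0` through the last coordinate, so `ψ`
would be constant.

The analytic input is Green's formula for the Laplacian and volume defined in charts. In one chart
it is the Euclidean divergence theorem, because the Christoffel terms are exactly those that put the
Laplacian in divergence form (`sum_partialD_fluxComponent`). A partition of unity makes it global
(`integral_mul_laplacian`). -/

noncomputable section

set_option linter.unusedSectionVars false

namespace SphereMaps

/-! ### The metric in charts and its behaviour under changes of coordinates. -/

section ChartCalculus

open Bundle Topology Set

variable {m : ℕ} {M : Type*} [TopologicalSpace M] [ChartedSpace (EuclideanSpace ℝ (Fin m)) M]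

theorem isOpen_target (c : M) : IsOpen (extChartAt (𝓡 m) c).target :=
  isOpen_extChartAt_target c

theorem isOpen_source (c : M) : IsOpen (extChartAt (𝓡 m) c).source :=
  isOpen_extChartAt_source c

variable [IsManifold (𝓡 m) ∞ M]

theorem contMDiffAt_symm (c : M) {y : EuclideanSpace ℝ (Fin m)}
    (hy : y ∈ (extChartAt (𝓡 m) c).target) :
    ContMDiffAt 𝓘(ℝ, EuclideanSpace ℝ (Fin m)) (𝓡 m) ∞ (extChartAt (𝓡 m) c).symm y :=
  (contMDiffOn_extChartAt_symm c).contMDiffAt ((isOpen_target c).mem_nhds hy)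

theorem mdifferentiableAt_symm (c : M) {y : EuclideanSpace ℝ (Fin m)}
    (hy : y ∈ (extChartAt (𝓡 m) c).target) :
    MDifferentiableAt 𝓘(ℝ, EuclideanSpace ℝ (Fin m)) (𝓡 m) (extChartAt (𝓡 m) c).symm y :=
  (contMDiffAt_symm c hy).mdifferentiableAt (by simp)

/-- The coordinate field is the image of a constant section under the tangent map of the inverse
chart, and that tangent map is smooth. -/
theorem contMDiffOn_coordVec (c : M) (i : Fin m) :
    ContMDiffOn 𝓘(ℝ, EuclideanSpace ℝ (Fin m)) (𝓡 m).tangent ∞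
      (fun y => (TotalSpace.mk' (EuclideanSpace ℝ (Fin m)) ((extChartAt (𝓡 m) c).symm y)
        (coordVec c y i) : TangentBundle (𝓡 m) M)) (extChartAt (𝓡 m) c).target := by
  have h1 := (contMDiffOn_extChartAt_symm (I := 𝓡 m) (n := ∞) c).contMDiffOn_tangentMapWithin
    (m := ∞) (by simp) (isOpen_target c).uniqueMDiffOn
  have h2 : ContMDiff 𝓘(ℝ, EuclideanSpace ℝ (Fin m)) (𝓘(ℝ, EuclideanSpace ℝ (Fin m))).tangent ∞
      (fun y : EuclideanSpace ℝ (Fin m) => (⟨y, EuclideanSpace.single i (1 : ℝ)⟩ :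
        TangentBundle 𝓘(ℝ, EuclideanSpace ℝ (Fin m)) (EuclideanSpace ℝ (Fin m)))) :=
    contMDiff_vectorSpace_iff_contDiff.2 contDiff_const
  have h3 := h1.comp (h2.contMDiffOn (s := (extChartAt (𝓡 m) c).target)) (fun y hy => hy)
  refine h3.congr fun y hy => ?_
  simp only [Function.comp, tangentMapWithin, coordVec]
  rw [mfderivWithin_of_isOpen (isOpen_target c) hy]

variable (g : Metr m M)

theorem contDiffOn_gram (c : M) (i j : Fin m) :
    ContDiffOn ℝ ∞ (fun y => gram g c y i j) (extChartAt (𝓡 m) c).target := by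
  have h0 := (g.contMDiff.comp_contMDiffOn (contMDiffOn_extChartAt_symm (I := 𝓡 m) (n := ∞) c))
  have h := ContMDiffOn.clm_bundle_apply₂ (F₃ := ℝ) (E₃ := Bundle.Trivial M ℝ)
    (ψ := fun y => g.inner ((extChartAt (𝓡 m) c).symm y))
    h0 (contMDiffOn_coordVec c i) (contMDiffOn_coordVec c j)
  rw [← contMDiffOn_iff_contDiffOn]
  intro y hy
  exact ((contMDiffWithinAt_totalSpace).1 (h y hy)).2

theorem gram_symm (c : M) (y : EuclideanSpace ℝ (Fin m)) (i j : Fin m) :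
    gram g c y i j = gram g c y j i := g.symm _ _ _

theorem mfderiv_symm_injective (c : M) {y : EuclideanSpace ℝ (Fin m)}
    (hy : y ∈ (extChartAt (𝓡 m) c).target) :
    Function.Injective (mfderiv 𝓘(ℝ, EuclideanSpace ℝ (Fin m)) (𝓡 m)
      (extChartAt (𝓡 m) c).symm y) := by
  have := isInvertible_mfderivWithin_extChartAt_symm (I := 𝓡 m) hy
  rw [ModelWithCorners.range_eq_univ, mfderivWithin_univ] at this
  exact this.injective

/-- The quadratic form of the Gram matrix at `v` is the squared `g`-length of the image of `v` under
the injective differential of the inverse chart. -/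
theorem gram_posDef (c : M) {y : EuclideanSpace ℝ (Fin m)}
    (hy : y ∈ (extChartAt (𝓡 m) c).target) : (gram g c y).PosDef := by
  refine Matrix.PosDef.of_dotProduct_mulVec_pos ?_ ?_
  · ext i j
    simp [gram_symm g c y i j]
  · intro v hv
    set T := mfderiv 𝓘(ℝ, EuclideanSpace ℝ (Fin m)) (𝓡 m) (extChartAt (𝓡 m) c).symm y with hT
    have hw : T (WithLp.toLp 2 v) ≠ 0 := by
      intro h
      have := mfderiv_symm_injective c hy (h.trans (map_zero T).symm)
      exact hv (by exact congrArg WithLp.ofLp this)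
    have hsum : T (WithLp.toLp 2 v) = ∑ i, v i • coordVec c y i := by
      have : (WithLp.toLp 2 v : EuclideanSpace ℝ (Fin m))
          = ∑ i, v i • EuclideanSpace.single i (1 : ℝ) := by
        ext j
        simp [Finset.sum_apply, Pi.single_apply]
      rw [this]
      refine (map_sum T _ _).trans (Finset.sum_congr rfl fun i _ => ?_)
      exact map_smul T _ _
    have := g.pos _ _ hw
    rw [hsum] at this
    simp only [map_sum, map_smul, sum_apply, smul_apply,
      smul_eq_mul] at this
    simp only [dotProduct, Matrix.mulVec, gram, Matrix.of_apply, Pi.star_apply, star_trivial]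
    refine this.trans_eq (Finset.sum_congr rfl fun i _ => ?_)
    congr 1
    refine Finset.sum_congr rfl fun j _ => ?_
    rw [g.symm, mul_comm]

theorem gram_det_pos (c : M) {y : EuclideanSpace ℝ (Fin m)}
    (hy : y ∈ (extChartAt (𝓡 m) c).target) : 0 < (gram g c y).det :=
  (gram_posDef g c hy).det_pos

theorem gram_isUnit_det (c : M) {y : EuclideanSpace ℝ (Fin m)}
    (hy : y ∈ (extChartAt (𝓡 m) c).target) : IsUnit (gram g c y).det :=
  (gram_det_pos g c hy).ne'.isUnit

theorem gram_inv_symm (c : M) (y : EuclideanSpace ℝ (Fin m)) (i j : Fin m) :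
    (gram g c y)⁻¹ i j = (gram g c y)⁻¹ j i := by
  have h : (gram g c y).transpose = gram g c y := by
    ext i j
    exact gram_symm g c y j i
  have h2 := Matrix.transpose_nonsing_inv (gram g c y)
  rw [h] at h2
  exact congrFun (congrFun h2 j) i

/-- The change of coordinates from the chart around `c'` to the chart around `c`. -/
def transition (c c' : M) (y : EuclideanSpace ℝ (Fin m)) : EuclideanSpace ℝ (Fin m) :=
  extChartAt (𝓡 m) c ((extChartAt (𝓡 m) c').symm y)

/-- The transposed Jacobian matrix `Aᵢⱼ = ∂ᵢθʲ` of the change of coordinates `θ`. -/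
def transitionJac (c c' : M) (y : EuclideanSpace ℝ (Fin m)) : Matrix (Fin m) (Fin m) ℝ :=
  Matrix.of fun i j => fderiv ℝ (transition c c') y (EuclideanSpace.single i (1 : ℝ)) j

theorem contDiffAt_transition {c c' : M} {y : EuclideanSpace ℝ (Fin m)}
    (hy : y ∈ (extChartAt (𝓡 m) c').target)
    (hy' : (extChartAt (𝓡 m) c').symm y ∈ (extChartAt (𝓡 m) c).source) :
    ContDiffAt ℝ ∞ (transition c c') y := by
  rw [← contMDiffAt_iff_contDiffAt]
  refine ContMDiffAt.comp y (contMDiffAt_extChartAt' ?_) (contMDiffAt_symm c' hy)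
  rwa [← extChartAt_source (𝓡 m)]

theorem transition_mem {c c' : M} {y : EuclideanSpace ℝ (Fin m)}
    (hy' : (extChartAt (𝓡 m) c').symm y ∈ (extChartAt (𝓡 m) c).source) :
    transition c c' y ∈ (extChartAt (𝓡 m) c).target :=
  (extChartAt (𝓡 m) c).map_source hy'

theorem symm_transition {c c' : M} {y : EuclideanSpace ℝ (Fin m)}
    (hy' : (extChartAt (𝓡 m) c').symm y ∈ (extChartAt (𝓡 m) c).source) :
    (extChartAt (𝓡 m) c).symm (transition c c' y) = (extChartAt (𝓡 m) c').symm y :=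
  (extChartAt (𝓡 m) c).left_inv hy'

theorem eventually_mem_overlap {c c' : M} {y : EuclideanSpace ℝ (Fin m)}
    (hy : y ∈ (extChartAt (𝓡 m) c').target)
    (hy' : (extChartAt (𝓡 m) c').symm y ∈ (extChartAt (𝓡 m) c).source) :
    ∀ᶠ z in 𝓝 y, (extChartAt (𝓡 m) c').symm z ∈ (extChartAt (𝓡 m) c).source :=
  (contMDiffAt_symm c' hy).continuousAt.eventually ((isOpen_source c).mem_nhds hy')

theorem fderiv_transition_single (c c' : M) (y : EuclideanSpace ℝ (Fin m)) (i : Fin m) :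
    fderiv ℝ (transition c c') y (EuclideanSpace.single i (1 : ℝ))
      = ∑ k, transitionJac c c' y i k • EuclideanSpace.single k (1 : ℝ) := by
  ext j
  simp [transitionJac, Pi.single_apply]

/-- Two inverse charts reach the same point only propositionally. Reading tangent vectors in the
model space lets the base point be replaced without transport. -/
theorem gram_apply_of_eq (c : M) {y : EuclideanSpace ℝ (Fin m)} {x : M}
    (h : (extChartAt (𝓡 m) c).symm y = x) (i j : Fin m) :
    gram g c y i j = g.inner x
      ((mfderiv 𝓘(ℝ, EuclideanSpace ℝ (Fin m)) (𝓡 m) (extChartAt (𝓡 m) c).symm y :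
        EuclideanSpace ℝ (Fin m) →L[ℝ] EuclideanSpace ℝ (Fin m)) (EuclideanSpace.single i (1 : ℝ)))
      ((mfderiv 𝓘(ℝ, EuclideanSpace ℝ (Fin m)) (𝓡 m) (extChartAt (𝓡 m) c).symm y :
        EuclideanSpace ℝ (Fin m) →L[ℝ] EuclideanSpace ℝ (Fin m))
          (EuclideanSpace.single j (1 : ℝ))) := by
  subst h
  rfl

theorem bilin_apply_comp_single
    (B : EuclideanSpace ℝ (Fin m) →L[ℝ] EuclideanSpace ℝ (Fin m) →L[ℝ] ℝ)
    (T S : EuclideanSpace ℝ (Fin m) →L[ℝ] EuclideanSpace ℝ (Fin m)) (A : Matrix (Fin m) (Fin m) ℝ)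
    (hS : ∀ i, S (EuclideanSpace.single i (1 : ℝ))
      = ∑ k, A i k • EuclideanSpace.single k (1 : ℝ)) (i j : Fin m) :
    B ((T.comp S) (EuclideanSpace.single i (1 : ℝ))) ((T.comp S) (EuclideanSpace.single j (1 : ℝ)))
      = ∑ l, (∑ k, A i k * B (T (EuclideanSpace.single k (1 : ℝ)))
          (T (EuclideanSpace.single l (1 : ℝ)))) * A j l := by
  simp only [ContinuousLinearMap.comp_apply, hS, map_sum, map_smul, sum_apply, smul_apply,
    smul_eq_mul]
  refine Finset.sum_congr rfl fun l _ => ?_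
  rw [mul_comm]

/-- Chain rule for the inverse charts, then bilinearity of the metric. The chart independence of
both the volume and `gradInner` rests on this identity. -/
theorem gram_transition {c c' : M} {y : EuclideanSpace ℝ (Fin m)}
    (hy : y ∈ (extChartAt (𝓡 m) c').target)
    (hy' : (extChartAt (𝓡 m) c').symm y ∈ (extChartAt (𝓡 m) c).source) :
    gram g c' y = transitionJac c c' y * gram g c (transition c c' y) *
      (transitionJac c c' y).transpose := by
  have hev : (extChartAt (𝓡 m) c').symm =ᶠ[𝓝 y]
      (extChartAt (𝓡 m) c).symm ∘ transition c c' :=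
    (eventually_mem_overlap hy hy').mono fun z hz => (symm_transition hz).symm
  have hd : mfderiv 𝓘(ℝ, EuclideanSpace ℝ (Fin m)) (𝓡 m) (extChartAt (𝓡 m) c').symm y
      = (mfderiv 𝓘(ℝ, EuclideanSpace ℝ (Fin m)) (𝓡 m) (extChartAt (𝓡 m) c).symm
          (transition c c' y) : EuclideanSpace ℝ (Fin m) →L[ℝ] EuclideanSpace ℝ (Fin m)).comp
        (fderiv ℝ (transition c c') y) := by
    rw [hev.mfderiv_eq, mfderiv_comp y (mdifferentiableAt_symm c (transition_mem hy'))
      ((contDiffAt_transition hy hy').differentiableAt (by simp)).mdifferentiableAt,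
      mfderiv_eq_fderiv]
    rfl
  ext i j
  rw [gram_apply_of_eq g c' rfl, hd]
  simp only [Matrix.mul_apply, Matrix.transpose_apply, gram_apply_of_eq g c (symm_transition hy')]
  exact bilin_apply_comp_single (m := m) (g.inner ((extChartAt (𝓡 m) c').symm y)) _ _ _
    (fderiv_transition_single c c' y) i j

theorem det_fderiv_transition (c c' : M) (y : EuclideanSpace ℝ (Fin m)) :
    (fderiv ℝ (transition c c') y).det = (transitionJac c c' y).det := by
  have : transitionJac c c' y = (LinearMap.toMatrix (EuclideanSpace.basisFun (Fin m) ℝ).toBasis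
      (EuclideanSpace.basisFun (Fin m) ℝ).toBasis
      (fderiv ℝ (transition c c') y : EuclideanSpace ℝ (Fin m) →ₗ[ℝ] _)).transpose := by
    ext i j
    simp [transitionJac, LinearMap.toMatrix_apply]
  rw [this, Matrix.det_transpose, LinearMap.det_toMatrix]

theorem sqrt_det_gram_transition {c c' : M} {y : EuclideanSpace ℝ (Fin m)}
    (hy : y ∈ (extChartAt (𝓡 m) c').target)
    (hy' : (extChartAt (𝓡 m) c').symm y ∈ (extChartAt (𝓡 m) c).source) :
    √(gram g c' y).det =
      |(fderiv ℝ (transition c c') y).det| * √(gram g c (transition c c' y)).det := by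
  rw [gram_transition g hy hy', Matrix.det_mul, Matrix.det_mul, Matrix.det_transpose,
    det_fderiv_transition, ← Real.sqrt_sq_eq_abs, ← Real.sqrt_mul (sq_nonneg _)]
  congr 1
  ring

/-- The function `f` read in the chart around `c`. -/
def chartRep (c : M) (f : M → ℝ) (y : EuclideanSpace ℝ (Fin m)) : ℝ :=
  f ((extChartAt (𝓡 m) c).symm y)

theorem contDiffOn_chartRep (c : M) {f : M → ℝ} (hf : ContMDiff (𝓡 m) 𝓘(ℝ, ℝ) ∞ f) :
    ContDiffOn ℝ ∞ (chartRep c f) (extChartAt (𝓡 m) c).target := by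
  rw [← contMDiffOn_iff_contDiffOn]
  exact hf.comp_contMDiffOn (contMDiffOn_extChartAt_symm c)

theorem partialD_transition {c c' : M} {y : EuclideanSpace ℝ (Fin m)}
    (hy : y ∈ (extChartAt (𝓡 m) c').target)
    (hy' : (extChartAt (𝓡 m) c').symm y ∈ (extChartAt (𝓡 m) c).source)
    {f : M → ℝ} (hf : ContMDiff (𝓡 m) 𝓘(ℝ, ℝ) ∞ f) (i : Fin m) :
    partialD i (chartRep c' f) y =
      ∑ k, transitionJac c c' y i k * partialD k (chartRep c f) (transition c c' y) := by
  have hev : chartRep c' f =ᶠ[𝓝 y] chartRep c f ∘ transition c c' :=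
    (eventually_mem_overlap hy hy').mono fun z hz => by
      simp only [chartRep, Function.comp, symm_transition hz]
  have h1 : DifferentiableAt ℝ (chartRep c f) (transition c c' y) :=
    ((contDiffOn_chartRep c hf).contDiffAt
      ((isOpen_target c).mem_nhds (transition_mem hy'))).differentiableAt (by simp)
  have h2 : DifferentiableAt ℝ (transition c c') y :=
    (contDiffAt_transition hy hy').differentiableAt (by simp)
  rw [partialD, hev.fderiv_eq, fderiv_comp y h1 h2, ContinuousLinearMap.comp_apply,
    fderiv_transition_single]
  simp [partialD]

/-- The inner product `⟨df, dh⟩ = gⁱʲ ∂ᵢf ∂ⱼh` in the chart around `c`, at coordinates `y`. -/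
def chartGradInner (c : M) (f h : M → ℝ) (y : EuclideanSpace ℝ (Fin m)) : ℝ :=
  ∑ i, ∑ j, (gram g c y)⁻¹ i j * (partialD i (chartRep c f) y * partialD j (chartRep c h) y)

/-- The inner product `⟨df, dh⟩` of the differentials of two functions. -/
def gradInner (f h : M → ℝ) (x : M) : ℝ :=
  chartGradInner g x f h (extChartAt (𝓡 m) x x)

theorem chartGradInner_eq_dotProduct (c : M) (f h : M → ℝ) (y : EuclideanSpace ℝ (Fin m)) :
    chartGradInner g c f h y = (fun i => partialD i (chartRep c f) y) ⬝ᵥ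
      ((gram g c y)⁻¹.mulVec fun j => partialD j (chartRep c h) y) := by
  simp only [chartGradInner, dotProduct, Matrix.mulVec, Finset.mul_sum]
  refine Finset.sum_congr rfl fun i _ => Finset.sum_congr rfl fun j _ => ?_
  ring

/-- With `G' = A G Aᵀ`, the partial derivatives transform by `A` and the inverse Gram matrix by
`A⁻ᵀ` and `A⁻¹`, so all Jacobians cancel. -/
theorem chartGradInner_transition {c c' : M} {y : EuclideanSpace ℝ (Fin m)}
    (hy : y ∈ (extChartAt (𝓡 m) c').target)
    (hy' : (extChartAt (𝓡 m) c').symm y ∈ (extChartAt (𝓡 m) c).source)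
    {f h : M → ℝ} (hf : ContMDiff (𝓡 m) 𝓘(ℝ, ℝ) ∞ f) (hh : ContMDiff (𝓡 m) 𝓘(ℝ, ℝ) ∞ h) :
    chartGradInner g c' f h y = chartGradInner g c f h (transition c c' y) := by
  have hG := gram_transition g hy hy'
  have hu := gram_isUnit_det g c' hy
  set A := transitionJac c c' y with hA
  -- Invertibility of the Jacobian is read off from that of `G' = A G Aᵀ`.
  have hAu : IsUnit A.det := by
    rw [hG, Matrix.det_mul, Matrix.det_mul] at hu
    exact isUnit_of_mul_isUnit_left (isUnit_of_mul_isUnit_left hu)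
  have hv : ∀ {f : M → ℝ}, ContMDiff (𝓡 m) 𝓘(ℝ, ℝ) ∞ f →
      (fun i => partialD i (chartRep c' f) y) =
        A.mulVec fun i => partialD i (chartRep c f) (transition c c' y) := fun hf => by
    ext i
    exact partialD_transition hy hy' hf i
  rw [chartGradInner_eq_dotProduct, chartGradInner_eq_dotProduct, hv hf, hv hh, hG,
    Matrix.mul_inv_rev, Matrix.mul_inv_rev, Matrix.mulVec_mulVec, Matrix.mul_assoc,
    Matrix.mul_assoc, Matrix.nonsing_inv_mul _ hAu, Matrix.mul_one, ← Matrix.mulVec_mulVec,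
    Matrix.dotProduct_mulVec, Matrix.vecMul_mulVec, ← Matrix.transpose_nonsing_inv,
    ← Matrix.transpose_mul, Matrix.nonsing_inv_mul _ hAu, Matrix.transpose_one, Matrix.vecMul_one]

theorem gradInner_symm_apply (c : M) {y : EuclideanSpace ℝ (Fin m)}
    (hy : y ∈ (extChartAt (𝓡 m) c).target)
    {f h : M → ℝ} (hf : ContMDiff (𝓡 m) 𝓘(ℝ, ℝ) ∞ f) (hh : ContMDiff (𝓡 m) 𝓘(ℝ, ℝ) ∞ h) :
    gradInner g f h ((extChartAt (𝓡 m) c).symm y) = chartGradInner g c f h y := by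
  rw [chartGradInner_transition g (c := (extChartAt (𝓡 m) c).symm y) hy
    (mem_extChartAt_source _) hf hh]
  rfl

end ChartCalculus

/-! ### Functions depending on a parameter, and differentiation of the operators in it. -/

section Families

open Topology Set

theorem contDiffOn_fderiv_apply_const {V : Type*} [NormedAddCommGroup V] [NormedSpace ℝ V]
    {F : Type*} [NormedAddCommGroup F] [NormedSpace ℝ F] {G : V → F} {S : Set V} (hS : IsOpen S)
    (hG : ContDiffOn ℝ ∞ G S) (v : V) : ContDiffOn ℝ ∞ (fun p => fderiv ℝ G p v) S :=
  (hG.fderiv_of_isOpen hS (m := ∞) (by simp)).clm_apply contDiffOn_const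

section Product

variable {V : Type*} [NormedAddCommGroup V] [NormedSpace ℝ V] {G : ℝ × V → ℝ} {U : Set V}

theorem hasFDerivAt_slice (hU : IsOpen U) (hG : ContDiffOn ℝ ∞ G (univ ×ˢ U)) (t : ℝ) {y : V}
    (hy : y ∈ U) :
    HasFDerivAt (fun z => G (t, z)) ((fderiv ℝ G (t, y)).comp (ContinuousLinearMap.inr ℝ ℝ V)) y :=
  (((hG.contDiffAt ((isOpen_univ.prod hU).mem_nhds ⟨mem_univ t, hy⟩)).differentiableAt
    (by simp)).hasFDerivAt).comp y (hasFDerivAt_prodMk_right t y)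

theorem hasDerivAt_slice (hU : IsOpen U) (hG : ContDiffOn ℝ ∞ G (univ ×ˢ U)) (t : ℝ) {y : V}
    (hy : y ∈ U) : HasDerivAt (fun s => G (s, y)) (fderiv ℝ G (t, y) (1, 0)) t := by
  have h := (((hG.contDiffAt ((isOpen_univ.prod hU).mem_nhds ⟨mem_univ t, hy⟩)).differentiableAt
    (by simp)).hasFDerivAt).comp t (hasFDerivAt_prodMk_left t y)
  have h' := h.hasDerivAt
  simp only [ContinuousLinearMap.comp_apply, ContinuousLinearMap.inl_apply] at h'
  exact h'

theorem fderiv_slice_apply (hU : IsOpen U) (hG : ContDiffOn ℝ ∞ G (univ ×ˢ U)) (t : ℝ) {y : V}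
    (hy : y ∈ U) (v : V) : fderiv ℝ (fun z => G (t, z)) y v = fderiv ℝ G (t, y) (0, v) := by
  rw [(hasFDerivAt_slice hU hG t hy).fderiv]
  simp

theorem contDiffOn_fderiv_slice (hU : IsOpen U) (hG : ContDiffOn ℝ ∞ G (univ ×ˢ U)) (v : V) :
    ContDiffOn ℝ ∞ (fun p : ℝ × V => fderiv ℝ (fun z => G (p.1, z)) p.2 v) (univ ×ˢ U) :=
  (contDiffOn_fderiv_apply_const (isOpen_univ.prod hU) hG (0, v)).congr fun p hp =>
    fderiv_slice_apply hU hG p.1 hp.2 v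

theorem contDiffOn_deriv_slice (hU : IsOpen U) (hG : ContDiffOn ℝ ∞ G (univ ×ˢ U)) :
    ContDiffOn ℝ ∞ (fun p : ℝ × V => deriv (fun s => G (s, p.2)) p.1) (univ ×ˢ U) :=
  (contDiffOn_fderiv_apply_const (isOpen_univ.prod hU) hG (1, 0)).congr fun p hp =>
    (hasDerivAt_slice hU hG p.1 hp.2).deriv

/-- Both orders of differentiation are the second derivative of `G` on the product in the directions
`(1, 0)` and `(0, v)`, which is symmetric. -/
theorem hasDerivAt_fderiv_slice (hU : IsOpen U) (hG : ContDiffOn ℝ ∞ G (univ ×ˢ U)) (t : ℝ)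
    {y : V} (hy : y ∈ U) (v : V) :
    HasDerivAt (fun s => fderiv ℝ (fun z => G (s, z)) y v)
      (fderiv ℝ (fun z => deriv (fun s => G (s, z)) t) y v) t := by
  have hS : IsOpen ((univ : Set ℝ) ×ˢ U) := isOpen_univ.prod hU
  have hmem : ((t, y) : ℝ × V) ∈ (univ : Set ℝ) ×ˢ U := ⟨mem_univ t, hy⟩
  have hd : DifferentiableAt ℝ (fderiv ℝ G) (t, y) :=
    ((hG.fderiv_of_isOpen hS (m := ∞) (by simp)).contDiffAt (hS.mem_nhds hmem)).differentiableAt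
      (by simp)
  have hsymm : IsSymmSndFDerivAt ℝ G (t, y) :=
    (hG.contDiffAt (hS.mem_nhds hmem)).isSymmSndFDerivAt
      (by simpa using (WithTop.coe_le_coe.2 le_top : ((2 : ℕ∞) : WithTop ℕ∞) ≤ ∞))
  have h1 := hasDerivAt_slice hU (contDiffOn_fderiv_slice hU hG v) t hy
  have e1 : fderiv ℝ (fun p : ℝ × V => fderiv ℝ (fun z => G (p.1, z)) p.2 v) (t, y) (1, 0)
      = fderiv ℝ (fderiv ℝ G) (t, y) (1, 0) (0, v) := by
    have : (fun p : ℝ × V => fderiv ℝ (fun z => G (p.1, z)) p.2 v) =ᶠ[𝓝 (t, y)]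
        fun p => fderiv ℝ G p (0, v) := by
      filter_upwards [hS.mem_nhds hmem] with p hp
      exact fderiv_slice_apply hU hG p.1 hp.2 v
    rw [this.fderiv_eq, fderiv_clm_apply hd (differentiableAt_const _)]
    simp
  have e2 : fderiv ℝ (fun z => deriv (fun s => G (s, z)) t) y v
      = fderiv ℝ (fderiv ℝ G) (t, y) (0, v) (1, 0) := by
    rw [fderiv_slice_apply hU (contDiffOn_deriv_slice hU hG) t hy v]
    have : (fun p : ℝ × V => deriv (fun s => G (s, p.2)) p.1) =ᶠ[𝓝 (t, y)]
        fun p => fderiv ℝ G p (1, 0) := by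
      filter_upwards [hS.mem_nhds hmem] with p hp
      exact (hasDerivAt_slice hU hG p.1 hp.2).deriv
    rw [this.fderiv_eq, fderiv_clm_apply hd (differentiableAt_const _)]
    simp
  rw [e2, ← hsymm.eq, ← e1]
  exact h1

end Product

variable {m : ℕ} {M : Type*} [TopologicalSpace M] [ChartedSpace (EuclideanSpace ℝ (Fin m)) M]
  [IsManifold (𝓡 m) ∞ M]

/-- Smoothness of a family of functions on `M` that depends on a real parameter. -/
abbrev IsSmoothFamily (m : ℕ) {M : Type*} [TopologicalSpace M]
    [ChartedSpace (EuclideanSpace ℝ (Fin m)) M] (F : ℝ → M → ℝ) : Prop :=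
  ContMDiff (𝓘(ℝ, ℝ).prod (𝓡 m)) 𝓘(ℝ, ℝ) ∞ (fun q : ℝ × M => F q.1 q.2)

/-- The derivative of a family of functions with respect to the parameter. -/
def timeDeriv (F : ℝ → M → ℝ) (t : ℝ) (x : M) : ℝ :=
  deriv (fun s => F s x) t

theorem IsSmoothFamily.contDiffOn {F : ℝ → M → ℝ} (hF : IsSmoothFamily m F) (c : M) :
    ContDiffOn ℝ ∞ (fun p : ℝ × EuclideanSpace ℝ (Fin m) => chartRep c (F p.1) p.2)
      (univ ×ˢ (extChartAt (𝓡 m) c).target) := by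
  rw [← contMDiffOn_iff_contDiffOn]
  rw [modelWithCornersSelf_prod, ← chartedSpaceSelf_prod]
  have h : ContMDiffOn (𝓘(ℝ, ℝ).prod 𝓘(ℝ, EuclideanSpace ℝ (Fin m))) (𝓘(ℝ, ℝ).prod (𝓡 m)) ∞
      (fun p : ℝ × EuclideanSpace ℝ (Fin m) => (p.1, (extChartAt (𝓡 m) c).symm p.2))
      (univ ×ˢ (extChartAt (𝓡 m) c).target) :=
    contMDiffOn_fst.prodMk ((contMDiffOn_extChartAt_symm c).comp contMDiffOn_snd fun p hp => hp.2)
  exact hF.comp_contMDiffOn h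

/-- `gradInner` and `laplacian` use a different chart at each point. Their smoothness is proved
through this criterion, once they are known to agree with the expression in any one fixed chart. -/
theorem IsSmoothFamily.of_contDiffOn {F : ℝ → M → ℝ}
    (hF : ∀ c : M, ContDiffOn ℝ ∞
      (fun p : ℝ × EuclideanSpace ℝ (Fin m) => chartRep c (F p.1) p.2)
      (univ ×ˢ (extChartAt (𝓡 m) c).target)) : IsSmoothFamily m F := by
  rintro ⟨t, x⟩
  have h2 : ContMDiffAt (𝓘(ℝ, ℝ).prod (𝓡 m)) (𝓘(ℝ, ℝ).prod 𝓘(ℝ, EuclideanSpace ℝ (Fin m))) ∞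
      (fun q : ℝ × M => (q.1, extChartAt (𝓡 m) x q.2)) (t, x) :=
    contMDiffAt_fst.prodMk (ContMDiffAt.comp (t, x) contMDiffAt_extChartAt contMDiffAt_snd)
  have h3 := ((hF x).contDiffAt ((isOpen_univ.prod (isOpen_target x)).mem_nhds
    (⟨mem_univ t, mem_extChartAt_target x⟩ : (t, extChartAt (𝓡 m) x x) ∈
      (univ : Set ℝ) ×ˢ (extChartAt (𝓡 m) x).target))).contMDiffAt
  rw [modelWithCornersSelf_prod, ← chartedSpaceSelf_prod] at h3
  refine (ContMDiffAt.comp (t, x) h3 h2).congr_of_eventuallyEq ?_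
  have : ∀ᶠ q : ℝ × M in 𝓝 (t, x), q.2 ∈ (extChartAt (𝓡 m) x).source :=
    continuous_snd.continuousAt.eventually ((isOpen_source x).mem_nhds (mem_extChartAt_source x))
  filter_upwards [this] with q hq
  simp only [Function.comp, chartRep, (extChartAt (𝓡 m) x).left_inv hq]

theorem IsSmoothFamily.const {f : M → ℝ} (hf : ContMDiff (𝓡 m) 𝓘(ℝ, ℝ) ∞ f) :
    IsSmoothFamily m (fun _ => f) :=
  hf.comp contMDiff_snd

theorem IsSmoothFamily.slice {F : ℝ → M → ℝ} (hF : IsSmoothFamily m F) (t : ℝ) :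
    ContMDiff (𝓡 m) 𝓘(ℝ, ℝ) ∞ (F t) :=
  ContMDiff.comp (g := fun q : ℝ × M => F q.1 q.2) hF
    (contMDiff_const.prodMk contMDiff_id : ContMDiff (𝓡 m) (𝓘(ℝ, ℝ).prod (𝓡 m)) ∞
      fun x : M => (t, x))

theorem IsSmoothFamily.timeDeriv {F : ℝ → M → ℝ} (hF : IsSmoothFamily m F) :
    IsSmoothFamily m (timeDeriv F) :=
  .of_contDiffOn fun c => contDiffOn_deriv_slice (isOpen_target c) (hF.contDiffOn c)

theorem IsSmoothFamily.hasDerivAt {F : ℝ → M → ℝ} (hF : IsSmoothFamily m F) (t : ℝ) (x : M) :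
    HasDerivAt (fun s => F s x) (SphereMaps.timeDeriv F t x) t := by
  have h := hasDerivAt_slice (isOpen_target x) (hF.contDiffOn x) t (mem_extChartAt_target x)
  simp only [chartRep, extChartAt_to_inv] at h
  exact h.differentiableAt.hasDerivAt

theorem IsSmoothFamily.continuous {F : ℝ → M → ℝ} (hF : IsSmoothFamily m F) :
    Continuous fun q : ℝ × M => F q.1 q.2 :=
  ContMDiff.continuous hF

theorem IsSmoothFamily.contDiffOn_partialD {F : ℝ → M → ℝ} (hF : IsSmoothFamily m F) (c : M)
    (i : Fin m) : ContDiffOn ℝ ∞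
      (fun p : ℝ × EuclideanSpace ℝ (Fin m) => partialD i (chartRep c (F p.1)) p.2)
      (univ ×ˢ (extChartAt (𝓡 m) c).target) :=
  contDiffOn_fderiv_slice (isOpen_target c) (hF.contDiffOn c) _

theorem IsSmoothFamily.contDiffOn_partialD_partialD {F : ℝ → M → ℝ} (hF : IsSmoothFamily m F)
    (c : M) (i j : Fin m) : ContDiffOn ℝ ∞
      (fun p : ℝ × EuclideanSpace ℝ (Fin m) => partialD i (partialD j (chartRep c (F p.1))) p.2)
      (univ ×ˢ (extChartAt (𝓡 m) c).target) :=
  contDiffOn_fderiv_slice (isOpen_target c) (hF.contDiffOn_partialD c j) _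

theorem IsSmoothFamily.hasDerivAt_partialD {F : ℝ → M → ℝ} (hF : IsSmoothFamily m F) (c : M)
    (i : Fin m) (t : ℝ) {y : EuclideanSpace ℝ (Fin m)} (hy : y ∈ (extChartAt (𝓡 m) c).target) :
    HasDerivAt (fun s => partialD i (chartRep c (F s)) y)
      (partialD i (chartRep c (SphereMaps.timeDeriv F t)) y) t :=
  hasDerivAt_fderiv_slice (isOpen_target c) (hF.contDiffOn c) t hy _

theorem IsSmoothFamily.hasDerivAt_partialD_partialD {F : ℝ → M → ℝ} (hF : IsSmoothFamily m F)
    (c : M) (i j : Fin m) (t : ℝ) {y : EuclideanSpace ℝ (Fin m)}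
    (hy : y ∈ (extChartAt (𝓡 m) c).target) :
    HasDerivAt (fun s => partialD i (partialD j (chartRep c (F s))) y)
      (partialD i (partialD j (chartRep c (SphereMaps.timeDeriv F t))) y) t := by
  have h := hasDerivAt_fderiv_slice (isOpen_target c) (hF.contDiffOn_partialD c j) t hy
    (EuclideanSpace.single i (1 : ℝ))
  have hev : (fun z => deriv (fun s => partialD j (chartRep c (F s)) z) t) =ᶠ[𝓝 y]
      partialD j (chartRep c (SphereMaps.timeDeriv F t)) := by
    filter_upwards [(isOpen_target c).mem_nhds hy] with z hz
    exact (hF.hasDerivAt_partialD c j t hz).deriv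
  rw [hev.fderiv_eq] at h
  exact h

theorem contDiffOn_matrix_det {V : Type*} [NormedAddCommGroup V] [NormedSpace ℝ V] {k : ℕ}
    {A : V → Matrix (Fin k) (Fin k) ℝ} {S : Set V}
    (hA : ∀ i j, ContDiffOn ℝ ∞ (fun y => A y i j) S) : ContDiffOn ℝ ∞ (fun y => (A y).det) S := by
  simp only [Matrix.det_apply, Units.smul_def, zsmul_eq_mul]
  exact ContDiffOn.sum fun σ _ => contDiffOn_const.mul (contDiffOn_prod fun i _ => hA _ _)

theorem contDiffOn_matrix_inv {V : Type*} [NormedAddCommGroup V] [NormedSpace ℝ V] {k : ℕ}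
    {A : V → Matrix (Fin k) (Fin k) ℝ} {S : Set V}
    (hA : ∀ i j, ContDiffOn ℝ ∞ (fun y => A y i j) S) (hdet : ∀ y ∈ S, (A y).det ≠ 0)
    (i j : Fin k) : ContDiffOn ℝ ∞ (fun y => (A y)⁻¹ i j) S := by
  simp only [Matrix.inv_def, Matrix.smul_apply, Ring.inverse_eq_inv', smul_eq_mul,
    Matrix.adjugate_apply]
  refine ((contDiffOn_matrix_det hA).inv hdet).mul (contDiffOn_matrix_det fun a b => ?_)
  simp only [Matrix.updateRow_apply]
  split_ifs
  · exact contDiffOn_const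
  · exact hA a b

variable (g : Metr m M)

theorem contDiffOn_gram_inv (c : M) (i j : Fin m) :
    ContDiffOn ℝ ∞ (fun y => (gram g c y)⁻¹ i j) (extChartAt (𝓡 m) c).target :=
  contDiffOn_matrix_inv (contDiffOn_gram g c) (fun _ hy => (gram_det_pos g c hy).ne') i j

theorem contDiffOn_sqrt_det_gram (c : M) :
    ContDiffOn ℝ ∞ (fun y => √(gram g c y).det) (extChartAt (𝓡 m) c).target :=
  (contDiffOn_matrix_det (contDiffOn_gram g c)).sqrt fun _ hy => (gram_det_pos g c hy).ne'

theorem contDiffOn_partialD (c : M) {f : EuclideanSpace ℝ (Fin m) → ℝ}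
    (hf : ContDiffOn ℝ ∞ f (extChartAt (𝓡 m) c).target) (i : Fin m) :
    ContDiffOn ℝ ∞ (partialD i f) (extChartAt (𝓡 m) c).target :=
  contDiffOn_fderiv_apply_const (isOpen_target c) hf _

theorem contDiffOn_christoffel (c : M) (k i j : Fin m) :
    ContDiffOn ℝ ∞ (fun y => christoffel g c y k i j) (extChartAt (𝓡 m) c).target := by
  unfold christoffel
  exact contDiffOn_const.mul (ContDiffOn.sum fun l _ => (contDiffOn_gram_inv g c k l).mul
    (((contDiffOn_partialD c (contDiffOn_gram g c j l) i).add
      (contDiffOn_partialD c (contDiffOn_gram g c i l) j)).sub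
      (contDiffOn_partialD c (contDiffOn_gram g c i j) l)))

/-- The Laplacian `Δf = gⁱʲ (∂ᵢ∂ⱼf - Γᵏᵢⱼ ∂ₖf)` in the chart around `c`, at coordinates `y`. -/
def chartLaplacian (c : M) (f : M → ℝ) (y : EuclideanSpace ℝ (Fin m)) : ℝ :=
  ∑ i, ∑ j, (gram g c y)⁻¹ i j * (partialD i (partialD j (chartRep c f)) y
    - ∑ k, christoffel g c y k i j * partialD k (chartRep c f) y)

/-- The Laplace–Beltrami operator. -/
def laplacian (f : M → ℝ) (x : M) : ℝ :=
  chartLaplacian g x f (extChartAt (𝓡 m) x x)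

theorem contDiffOn_comp_snd {V : Type*} [NormedAddCommGroup V] [NormedSpace ℝ V] {f : V → ℝ}
    {U : Set V} (hf : ContDiffOn ℝ ∞ f U) :
    ContDiffOn ℝ ∞ (fun p : ℝ × V => f p.2) (univ ×ˢ U) :=
  hf.comp contDiffOn_snd fun _ hp => hp.2

theorem IsSmoothFamily.contDiffOn_chartGradInner {F H : ℝ → M → ℝ} (hF : IsSmoothFamily m F)
    (hH : IsSmoothFamily m H) (c : M) : ContDiffOn ℝ ∞
      (fun p : ℝ × EuclideanSpace ℝ (Fin m) => chartGradInner g c (F p.1) (H p.1) p.2)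
      (univ ×ˢ (extChartAt (𝓡 m) c).target) :=
  ContDiffOn.sum fun i _ => ContDiffOn.sum fun j _ =>
    (contDiffOn_comp_snd (contDiffOn_gram_inv g c i j)).mul
      ((hF.contDiffOn_partialD c i).mul (hH.contDiffOn_partialD c j))

theorem IsSmoothFamily.contDiffOn_chartLaplacian {F : ℝ → M → ℝ} (hF : IsSmoothFamily m F)
    (c : M) : ContDiffOn ℝ ∞
      (fun p : ℝ × EuclideanSpace ℝ (Fin m) => chartLaplacian g c (F p.1) p.2)
      (univ ×ˢ (extChartAt (𝓡 m) c).target) := by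
  unfold chartLaplacian
  exact ContDiffOn.sum fun i _ => ContDiffOn.sum fun j _ =>
    (contDiffOn_comp_snd (contDiffOn_gram_inv g c i j)).mul
      ((hF.contDiffOn_partialD_partialD c i j).sub (ContDiffOn.sum fun k _ =>
        (contDiffOn_comp_snd (contDiffOn_christoffel g c k i j)).mul (hF.contDiffOn_partialD c k)))

theorem contDiffOn_of_slice {V : Type*} [NormedAddCommGroup V] [NormedSpace ℝ V]
    {U : Set V} {f : V → ℝ} (h : ContDiffOn ℝ ∞ (fun p : ℝ × V => f p.2) (univ ×ˢ U)) :
    ContDiffOn ℝ ∞ f U :=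
  h.comp (contDiffOn_const (c := (0 : ℝ)).prodMk contDiffOn_id) fun _ hy => ⟨mem_univ _, hy⟩

theorem contDiffOn_chartLaplacian (c : M) {f : M → ℝ} (hf : ContMDiff (𝓡 m) 𝓘(ℝ, ℝ) ∞ f) :
    ContDiffOn ℝ ∞ (chartLaplacian g c f) (extChartAt (𝓡 m) c).target :=
  contDiffOn_of_slice ((IsSmoothFamily.const hf).contDiffOn_chartLaplacian g c)

theorem IsSmoothFamily.gradInner {F H : ℝ → M → ℝ} (hF : IsSmoothFamily m F)
    (hH : IsSmoothFamily m H) : IsSmoothFamily m (fun t => gradInner g (F t) (H t)) :=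
  .of_contDiffOn fun c => (hF.contDiffOn_chartGradInner g hH c).congr fun p hp =>
    gradInner_symm_apply g c hp.2 (hF.slice p.1) (hH.slice p.1)

theorem contMDiff_gradInner {f h : M → ℝ} (hf : ContMDiff (𝓡 m) 𝓘(ℝ, ℝ) ∞ f)
    (hh : ContMDiff (𝓡 m) 𝓘(ℝ, ℝ) ∞ h) : ContMDiff (𝓡 m) 𝓘(ℝ, ℝ) ∞ (gradInner g f h) :=
  ((IsSmoothFamily.const hf).gradInner g (.const hh)).slice 0

theorem IsSmoothFamily.hasDerivAt_gradInner {F H : ℝ → M → ℝ} (hF : IsSmoothFamily m F)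
    (hH : IsSmoothFamily m H) (t : ℝ) (x : M) :
    HasDerivAt (fun s => SphereMaps.gradInner g (F s) (H s) x)
      (SphereMaps.gradInner g (SphereMaps.timeDeriv F t) (H t) x
        + SphereMaps.gradInner g (F t) (SphereMaps.timeDeriv H t) x) t := by
  simp only [SphereMaps.gradInner, chartGradInner, ← Finset.sum_add_distrib, ← mul_add]
  exact HasDerivAt.fun_sum fun i _ => HasDerivAt.fun_sum fun j _ =>
    ((hF.hasDerivAt_partialD x i t (mem_extChartAt_target x)).mul
      (hH.hasDerivAt_partialD x j t (mem_extChartAt_target x))).const_mul _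

theorem IsSmoothFamily.hasDerivAt_laplacian {F : ℝ → M → ℝ} (hF : IsSmoothFamily m F) (t : ℝ)
    (x : M) : HasDerivAt (fun s => laplacian g (F s) x)
      (laplacian g (SphereMaps.timeDeriv F t) x) t := by
  unfold laplacian chartLaplacian
  exact HasDerivAt.fun_sum fun i _ => HasDerivAt.fun_sum fun j _ =>
    ((hF.hasDerivAt_partialD_partialD x i j t (mem_extChartAt_target x)).sub
      (HasDerivAt.fun_sum fun k _ =>
        (hF.hasDerivAt_partialD x k t (mem_extChartAt_target x)).const_mul _)).const_mul _

end Families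

/-! ### The Laplacian in divergence form. -/

section DivergenceForm

open Topology Set

/-- Jacobi's formula. The product rule on the permutation expansion differentiates one column at a
time, and Cramer's rule expresses a determinant with one column replaced through the adjugate. -/
theorem hasDerivAt_matrix_det {k : ℕ} {A : ℝ → Matrix (Fin k) (Fin k) ℝ}
    {A' : Matrix (Fin k) (Fin k) ℝ} {t : ℝ}
    (hA : ∀ i j, HasDerivAt (fun s => A s i j) (A' i j) t) :
    HasDerivAt (fun s => (A s).det) (∑ i, ∑ j, (A t).adjugate i j * A' j i) t := by
  have h1 : HasDerivAt (fun s => ∑ σ : Equiv.Perm (Fin k),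
      ((Equiv.Perm.sign σ : ℤ) : ℝ) * ∏ i, A s (σ i) i)
      (∑ σ : Equiv.Perm (Fin k), ((Equiv.Perm.sign σ : ℤ) : ℝ) *
        ∑ i, (∏ j ∈ Finset.univ.erase i, A t (σ j) j) • A' (σ i) i) t :=
    HasDerivAt.fun_sum fun σ _ =>
      (HasDerivAt.fun_finsetProd fun i _ => hA (σ i) i).const_mul _
  have h2 : ∀ i, ∑ j, (A t).adjugate i j * A' j i =
      ∑ σ : Equiv.Perm (Fin k), ((Equiv.Perm.sign σ : ℤ) : ℝ) *
        ((∏ j ∈ Finset.univ.erase i, A t (σ j) j) • A' (σ i) i) := fun i => by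
    have : ∑ j, (A t).adjugate i j * A' j i = ((A t).updateCol i fun j => A' j i).det := by
      rw [← Matrix.cramer_apply, Matrix.cramer_eq_adjugate_mulVec]
      rfl
    rw [this, Matrix.det_apply]
    refine Finset.sum_congr rfl fun σ _ => ?_
    rw [Units.smul_def, zsmul_eq_mul, ← Finset.mul_prod_erase _ _ (Finset.mem_univ i)]
    congr 1
    rw [Matrix.updateCol_self, smul_eq_mul, mul_comm]
    congr 1
    refine Finset.prod_congr rfl fun j hj => ?_
    rw [Matrix.updateCol_ne (Finset.ne_of_mem_erase hj)]
  simp only [h2]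
  rw [Finset.sum_comm]
  simp only [← Finset.mul_sum]
  convert h1 using 2
  rw [Matrix.det_apply]
  simp [Units.smul_def]

/-- Here `I` stands for `g⁻¹` and `dG i a b` for `∂ᵢ g_ab`. Of the three terms of a Christoffel
symbol, the first two coincide after contraction with the symmetric `I`. They match the derivative
of the inverse metric, and the third matches the derivative of `√det g`. -/
theorem contracted_christoffel_identity {m : ℕ} (I : Matrix (Fin m) (Fin m) ℝ)
    (dG : Fin m → Fin m → Fin m → ℝ) (hI : ∀ i j, I i j = I j i)
    (k : Fin m) :
    ∑ i, ((1 / 2) * (∑ a, ∑ b, I a b * dG i a b) * I i k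
        - ∑ a, ∑ b, I i a * dG i a b * I b k)
      = - ∑ i, ∑ j, I i j * ((1 / 2) * ∑ l, I k l * (dG i j l + dG j i l - dG l i j)) := by
  have e1 : ∑ i, (1 / 2) * (∑ a, ∑ b, I a b * dG i a b) * I i k
      = (1 / 2) * ∑ i, ∑ j, ∑ l, I i j * I k l * dG l i j := by
    simp only [Finset.mul_sum, Finset.sum_mul]
    rw [Finset.sum_comm]
    refine Finset.sum_congr rfl fun a _ => ?_
    rw [Finset.sum_comm]
    refine Finset.sum_congr rfl fun b _ => Finset.sum_congr rfl fun l _ => ?_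
    rw [hI l k]
    ring
  have e2 : ∑ i, ∑ a, ∑ b, I i a * dG i a b * I b k
      = ∑ i, ∑ j, ∑ l, I i j * I k l * dG i j l :=
    Finset.sum_congr rfl fun i _ => Finset.sum_congr rfl fun j _ =>
      Finset.sum_congr rfl fun l _ => by rw [hI l k]; ring
  have e3 : ∑ i, ∑ j, ∑ l, I i j * I k l * dG j i l
      = ∑ i, ∑ j, ∑ l, I i j * I k l * dG i j l := by
    rw [Finset.sum_comm]
    exact Finset.sum_congr rfl fun i _ => Finset.sum_congr rfl fun j _ =>
      Finset.sum_congr rfl fun l _ => by rw [hI j i]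
  have e4 : ∑ i, ∑ j, I i j * ((1 / 2) * ∑ l, I k l * (dG i j l + dG j i l - dG l i j))
      = (1 / 2) * (∑ i, ∑ j, ∑ l, I i j * I k l * dG i j l)
        + (1 / 2) * (∑ i, ∑ j, ∑ l, I i j * I k l * dG j i l)
        - (1 / 2) * ∑ i, ∑ j, ∑ l, I i j * I k l * dG l i j := by
    simp only [Finset.mul_sum, ← Finset.sum_add_distrib, ← Finset.sum_sub_distrib]
    exact Finset.sum_congr rfl fun i _ => Finset.sum_congr rfl fun j _ =>
      Finset.sum_congr rfl fun l _ => by ring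
  rw [Finset.sum_sub_distrib, e1, e2, e4, e3]
  ring

variable {m : ℕ} {M : Type*} [TopologicalSpace M] [ChartedSpace (EuclideanSpace ℝ (Fin m)) M]
  [IsManifold (𝓡 m) ∞ M] (g : Metr m M)

theorem hasDerivAt_partialD {f : EuclideanSpace ℝ (Fin m) → ℝ} {y : EuclideanSpace ℝ (Fin m)}
    (hf : DifferentiableAt ℝ f y) (i : Fin m) :
    HasDerivAt (fun s : ℝ => f (y + s • EuclideanSpace.single i (1 : ℝ))) (partialD i f y) 0 :=
  hf.hasFDerivAt.hasLineDerivAt _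

theorem differentiableAt_of_contDiffOn (c : M) {F : Type*} [NormedAddCommGroup F]
    [NormedSpace ℝ F] {f : EuclideanSpace ℝ (Fin m) → F}
    (hf : ContDiffOn ℝ ∞ f (extChartAt (𝓡 m) c).target) {y : EuclideanSpace ℝ (Fin m)}
    (hy : y ∈ (extChartAt (𝓡 m) c).target) : DifferentiableAt ℝ f y :=
  (hf.contDiffAt ((isOpen_target c).mem_nhds hy)).differentiableAt (by simp)

/-- Jacobi's formula along a coordinate line, with the adjugate written as the determinant times the
inverse. -/
theorem partialD_sqrt_det_gram (c : M) {y : EuclideanSpace ℝ (Fin m)}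
    (hy : y ∈ (extChartAt (𝓡 m) c).target) (i : Fin m) :
    partialD i (fun z => √(gram g c z).det) y = √(gram g c y).det *
      ((1 / 2) * ∑ a, ∑ b, (gram g c y)⁻¹ a b * partialD i (fun z => gram g c z a b) y) := by
  have hpos := gram_det_pos g c hy
  have h1 := hasDerivAt_matrix_det
    (A := fun s : ℝ => gram g c (y + s • EuclideanSpace.single i (1 : ℝ)))
    (A' := Matrix.of fun a b => partialD i (fun z => gram g c z a b) y) (t := 0) fun a b =>
      hasDerivAt_partialD (differentiableAt_of_contDiffOn c (contDiffOn_gram g c a b) hy) i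
  simp only [zero_smul, add_zero, Matrix.of_apply] at h1
  have h2 := h1.sqrt (by simpa using hpos.ne')
  have h3 := hasDerivAt_partialD
    (differentiableAt_of_contDiffOn c (contDiffOn_sqrt_det_gram g c) hy) i
  rw [h3.unique h2]
  simp only [zero_smul, add_zero]
  have hs : √(gram g c y).det ≠ 0 := (Real.sqrt_pos.2 hpos).ne'
  have hadj : ∀ a b, (gram g c y).adjugate a b = (gram g c y).det * (gram g c y)⁻¹ a b := by
    intro a b
    rw [Matrix.inv_def, Matrix.smul_apply, Ring.inverse_eq_inv', smul_eq_mul,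
      mul_inv_cancel_left₀ hpos.ne']
  have hsymm : ∀ a b, partialD i (fun z => gram g c z b a) y
      = partialD i (fun z => gram g c z a b) y := fun a b => by
    simp only [gram_symm g c _ b a]
  simp only [hadj, hsymm, mul_assoc, ← Finset.mul_sum]
  rw [div_eq_iff (by positivity)]
  nth_rewrite 1 [← Real.mul_self_sqrt hpos.le]
  ring

theorem partialD_gram_inv (c : M) {y : EuclideanSpace ℝ (Fin m)}
    (hy : y ∈ (extChartAt (𝓡 m) c).target) (i a d : Fin m) :
    partialD i (fun z => (gram g c z)⁻¹ a d) y = - ∑ b, ∑ e, (gram g c y)⁻¹ a b *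
      partialD i (fun z => gram g c z b e) y * (gram g c y)⁻¹ e d := by
  set dG : Matrix (Fin m) (Fin m) ℝ := Matrix.of fun a b => partialD i (fun z => gram g c z a b) y
    with hdG
  set dI : Matrix (Fin m) (Fin m) ℝ :=
    Matrix.of fun a b => partialD i (fun z => (gram g c z)⁻¹ a b) y with hdI
  -- Differentiate `G⁻¹ G = 1`, which holds along the coordinate line as long as it stays in the
  -- chart target.
  have key : dI * gram g c y + (gram g c y)⁻¹ * dG = 0 := by
    ext a b
    have h1 : HasDerivAt (fun s : ℝ =>
        ((gram g c (y + s • EuclideanSpace.single i (1 : ℝ)))⁻¹ *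
          gram g c (y + s • EuclideanSpace.single i (1 : ℝ))) a b)
        ((dI * gram g c y + (gram g c y)⁻¹ * dG) a b) 0 := by
      simp only [Matrix.add_apply, Matrix.mul_apply, ← Finset.sum_add_distrib]
      refine HasDerivAt.fun_sum fun e _ => ?_
      have := (hasDerivAt_partialD
        (differentiableAt_of_contDiffOn c (contDiffOn_gram_inv g c a e) hy) i).mul
        (hasDerivAt_partialD (differentiableAt_of_contDiffOn c (contDiffOn_gram g c e b) hy) i)
      simp only [zero_smul, add_zero] at this
      exact this
    have h2 : (fun s : ℝ => ((gram g c (y + s • EuclideanSpace.single i (1 : ℝ)))⁻¹ *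
          gram g c (y + s • EuclideanSpace.single i (1 : ℝ))) a b) =ᶠ[𝓝 0]
        fun _ => (1 : Matrix (Fin m) (Fin m) ℝ) a b := by
      have hc : ContinuousAt (fun s : ℝ => y + s • EuclideanSpace.single i (1 : ℝ)) 0 := by
        fun_prop
      filter_upwards [hc.eventually ((isOpen_target c).mem_nhds (by simpa using hy))] with s hs
      rw [Matrix.nonsing_inv_mul _ (gram_isUnit_det g c hs)]
    rw [h1.unique ((hasDerivAt_const (0 : ℝ) _).congr_of_eventuallyEq h2)]
    rfl
  have : dI = - ((gram g c y)⁻¹ * dG * (gram g c y)⁻¹) := by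
    have h := congrArg (· * (gram g c y)⁻¹) (eq_neg_of_add_eq_zero_left key)
    simpa [Matrix.mul_assoc, Matrix.mul_nonsing_inv _ (gram_isUnit_det g c hy)] using h
  have h := congrFun (congrFun this a) d
  simp only [hdI, Matrix.of_apply, Matrix.neg_apply, Matrix.mul_apply, Finset.sum_mul] at h
  rw [h, Finset.sum_comm]
  rfl

theorem contracted_christoffel (c : M) {y : EuclideanSpace ℝ (Fin m)}
    (hy : y ∈ (extChartAt (𝓡 m) c).target) (k : Fin m) :
    ∑ i, (partialD i (fun z => √(gram g c z).det) y * (gram g c y)⁻¹ i k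
        + √(gram g c y).det * partialD i (fun z => (gram g c z)⁻¹ i k) y)
      = - (√(gram g c y).det * ∑ i, ∑ j, (gram g c y)⁻¹ i j * christoffel g c y k i j) := by
  simp only [christoffel]
  rw [← mul_neg, ← contracted_christoffel_identity (gram g c y)⁻¹
    (fun i a b => partialD i (fun z => gram g c z a b) y) (gram_inv_symm g c y) k, Finset.mul_sum]
  refine Finset.sum_congr rfl fun i _ => ?_
  rw [partialD_sqrt_det_gram g c hy, partialD_gram_inv g c hy]
  ring

/-- The `i`-th component of the vector field `√(det g) h ∇f` in the chart around `c`. -/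
def fluxComponent (c : M) (f h : M → ℝ) (i : Fin m) (y : EuclideanSpace ℝ (Fin m)) : ℝ :=
  √(gram g c y).det * ∑ j, (gram g c y)⁻¹ i j * (chartRep c h y * partialD j (chartRep c f) y)

theorem contDiffOn_fluxComponent (c : M) {f h : M → ℝ} (hf : ContMDiff (𝓡 m) 𝓘(ℝ, ℝ) ∞ f)
    (hh : ContMDiff (𝓡 m) 𝓘(ℝ, ℝ) ∞ h) (i : Fin m) :
    ContDiffOn ℝ ∞ (fluxComponent g c f h i) (extChartAt (𝓡 m) c).target :=
  (contDiffOn_sqrt_det_gram g c).mul (ContDiffOn.sum fun j _ => (contDiffOn_gram_inv g c i j).mul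
    ((contDiffOn_chartRep c hh).mul (contDiffOn_partialD c (contDiffOn_chartRep c hf) j)))

/-- The derivative falls on `√det g · g⁻¹`, on `h` or on `∂f`. The first case yields the Christoffel
terms by `contracted_christoffel`, the second the gradient product, the third the second
derivatives. The integrand of Green's formula is thus a Euclidean divergence. -/
theorem sum_partialD_fluxComponent (c : M) {f h : M → ℝ} (hf : ContMDiff (𝓡 m) 𝓘(ℝ, ℝ) ∞ f)
    (hh : ContMDiff (𝓡 m) 𝓘(ℝ, ℝ) ∞ h) {y : EuclideanSpace ℝ (Fin m)}
    (hy : y ∈ (extChartAt (𝓡 m) c).target) :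
    ∑ i, partialD i (fluxComponent g c f h i) y = √(gram g c y).det *
      (chartRep c h y * chartLaplacian g c f y + chartGradInner g c f h y) := by
  have hd : ∀ i, partialD i (fluxComponent g c f h i) y =
      partialD i (fun z => √(gram g c z).det) y * (∑ j, (gram g c y)⁻¹ i j *
        (chartRep c h y * partialD j (chartRep c f) y))
      + √(gram g c y).det * ∑ j, (partialD i (fun z => (gram g c z)⁻¹ i j) y *
          (chartRep c h y * partialD j (chartRep c f) y) + (gram g c y)⁻¹ i j *
          (partialD i (chartRep c h) y * partialD j (chartRep c f) y
            + chartRep c h y * partialD i (partialD j (chartRep c f)) y)) := fun i => by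
    have h1 := hasDerivAt_partialD (differentiableAt_of_contDiffOn c
      (contDiffOn_fluxComponent g c hf hh i) hy) i
    refine h1.unique ?_
    have h2 := (hasDerivAt_partialD
      (differentiableAt_of_contDiffOn c (contDiffOn_sqrt_det_gram g c) hy) i).mul
      (HasDerivAt.fun_sum (u := Finset.univ) fun j _ => (hasDerivAt_partialD
        (differentiableAt_of_contDiffOn c (contDiffOn_gram_inv g c i j) hy) i).mul
        ((hasDerivAt_partialD
          (differentiableAt_of_contDiffOn c (contDiffOn_chartRep c hh) hy) i).mul
          (hasDerivAt_partialD (differentiableAt_of_contDiffOn c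
            (contDiffOn_partialD c (contDiffOn_chartRep c hf) j) hy) i)))
    simp only [Pi.mul_apply, zero_smul, add_zero] at h2
    exact h2
  have hk := fun k => contracted_christoffel g c hy k
  have e1 : ∑ i, partialD i (fluxComponent g c f h i) y =
      ∑ k, (∑ i, (partialD i (fun z => √(gram g c z).det) y * (gram g c y)⁻¹ i k
        + √(gram g c y).det * partialD i (fun z => (gram g c z)⁻¹ i k) y)) *
          (chartRep c h y * partialD k (chartRep c f) y)
      + √(gram g c y).det * ∑ i, ∑ j, (gram g c y)⁻¹ i j *
          (partialD i (chartRep c h) y * partialD j (chartRep c f) y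
            + chartRep c h y * partialD i (partialD j (chartRep c f)) y) := by
    simp only [hd, Finset.sum_mul, Finset.mul_sum]
    rw [Finset.sum_comm (γ := Fin m) (f := fun k i => _ * (chartRep c h y * _)),
      ← Finset.sum_add_distrib]
    refine Finset.sum_congr rfl fun i _ => ?_
    rw [← Finset.sum_add_distrib, ← Finset.sum_add_distrib]
    refine Finset.sum_congr rfl fun j _ => ?_
    ring
  have e2 : ∑ k, (∑ i, ∑ j, (gram g c y)⁻¹ i j * christoffel g c y k i j) *
      (chartRep c h y * partialD k (chartRep c f) y) =
      chartRep c h y * ∑ i, ∑ j, (gram g c y)⁻¹ i j *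
        ∑ k, christoffel g c y k i j * partialD k (chartRep c f) y := by
    simp only [Finset.sum_mul, Finset.mul_sum]
    rw [Finset.sum_comm]
    refine Finset.sum_congr rfl fun i _ => ?_
    rw [Finset.sum_comm]
    refine Finset.sum_congr rfl fun j _ => Finset.sum_congr rfl fun k _ => ?_
    ring
  have e3 : chartGradInner g c f h y = ∑ i, ∑ j, (gram g c y)⁻¹ i j *
      (partialD i (chartRep c h) y * partialD j (chartRep c f) y) := by
    rw [chartGradInner, Finset.sum_comm]
    refine Finset.sum_congr rfl fun i _ => Finset.sum_congr rfl fun j _ => ?_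
    rw [gram_inv_symm g c y j i]
    ring
  rw [e1, e3, chartLaplacian]
  simp only [hk, neg_mul, mul_assoc, Finset.sum_neg_distrib, ← Finset.mul_sum, e2, mul_add,
    mul_sub, Finset.sum_add_distrib, Finset.sum_sub_distrib]
  simp only [mul_left_comm _ (chartRep c h y), ← Finset.mul_sum]
  ring

end DivergenceForm

/-! ### The Riemannian volume: chart independence, finiteness and positivity on open sets. -/

section VolumeMeasure

open Topology Set

variable {m : ℕ} {M : Type*} [TopologicalSpace M] [ChartedSpace (EuclideanSpace ℝ (Fin m)) M]
  [IsManifold (𝓡 m) ∞ M] (g : Metr m M)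

/-- The part of the chart around `c` that lies over the chart around `c'`. -/
def overlap (c c' : M) : Set (EuclideanSpace ℝ (Fin m)) :=
  (extChartAt (𝓡 m) c).target ∩ (extChartAt (𝓡 m) c).symm ⁻¹' (extChartAt (𝓡 m) c').source

theorem isOpen_overlap (c c' : M) : IsOpen (overlap (m := m) c c') :=
  (continuousOn_extChartAt_symm c).isOpen_inter_preimage (isOpen_target c) (isOpen_source c')

theorem transition_transition {c c' : M} {y : EuclideanSpace ℝ (Fin m)}
    (hy : y ∈ overlap c' c) : transition c' c (transition c c' y) = y := by
  rw [transition, symm_transition hy.2, (extChartAt (𝓡 m) c').right_inv hy.1]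

theorem mapsTo_transition (c c' : M) :
    MapsTo (transition (m := m) c c') (overlap c' c) (overlap c c') := fun y hy => by
  refine ⟨transition_mem hy.2, ?_⟩
  rw [mem_preimage, symm_transition hy.2]
  exact (extChartAt (𝓡 m) c').map_target hy.1

theorem image_transition (c c' : M) :
    transition (m := m) c c' '' overlap c' c = overlap c c' := by
  refine (mapsTo_transition c c').image_subset.antisymm fun y hy => ?_
  exact ⟨transition c' c y, mapsTo_transition c' c hy, transition_transition hy⟩

theorem injOn_transition (c c' : M) : InjOn (transition (m := m) c c') (overlap c' c) :=
  fun y hy z hz h => by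
    rw [← transition_transition hy, h, transition_transition hz]

/-- Change of variables along the transition map: the Jacobian determinant is absorbed by the
transformation of `√det g`. -/
theorem setIntegral_overlap (c c' : M) (F : M → ℝ) :
    ∫ y in overlap (m := m) c c', F ((extChartAt (𝓡 m) c).symm y) * √(gram g c y).det =
      ∫ y in overlap (m := m) c' c, F ((extChartAt (𝓡 m) c').symm y) * √(gram g c' y).det := by
  rw [← image_transition c c', integral_image_eq_integral_abs_det_fderiv_smul volume
    (isOpen_overlap c' c).measurableSet (fun y hy =>
      ((contDiffAt_transition hy.1 hy.2).differentiableAt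
        (by simp)).hasFDerivAt.hasFDerivWithinAt) (injOn_transition c c')]
  refine setIntegral_congr_fun (isOpen_overlap c' c).measurableSet fun y hy => ?_
  simp only [smul_eq_mul]
  rw [symm_transition hy.2, sqrt_det_gram_transition g hy.1 hy.2]
  ring

variable [CompactSpace M]

/-- The factor `q` is uncontrolled near the edge of the chart target, but the product vanishes off
the compact image of the support of `w`. -/
theorem integrableOn_target_of_tsupport_subset {c : M} {w : M → ℝ}
    (hw : Continuous w) (hsupp : tsupport w ⊆ (extChartAt (𝓡 m) c).source)
    {q : EuclideanSpace ℝ (Fin m) → ℝ} (hq : ContinuousOn q (extChartAt (𝓡 m) c).target) :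
    IntegrableOn (fun y => w ((extChartAt (𝓡 m) c).symm y) * q y)
      (extChartAt (𝓡 m) c).target := by
  have hK : IsCompact (extChartAt (𝓡 m) c '' tsupport w) :=
    (isClosed_tsupport w).isCompact.image_of_continuousOn ((continuousOn_extChartAt c).mono hsupp)
  have hKT : extChartAt (𝓡 m) c '' tsupport w ⊆ (extChartAt (𝓡 m) c).target := by
    rintro _ ⟨x, hx, rfl⟩
    exact (extChartAt (𝓡 m) c).map_source (hsupp hx)
  have hc : ContinuousOn (fun y => w ((extChartAt (𝓡 m) c).symm y) * q y)
      (extChartAt (𝓡 m) c).target :=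
    (hw.comp_continuousOn (continuousOn_extChartAt_symm c)).mul hq
  refine ((hc.mono hKT).integrableOn_compact hK).of_forall_sdiff_eq_zero
    (isOpen_target c).measurableSet fun y hy => ?_
  have : w ((extChartAt (𝓡 m) c).symm y) = 0 := by
    refine image_eq_zero_of_notMem_tsupport fun h => hy.2 ⟨_, h, ?_⟩
    exact (extChartAt (𝓡 m) c).right_inv hy.1
  simp only [this, zero_mul]

variable [T2Space M]

theorem chartPartition_tsupport_subset (c : M) :
    tsupport (chartPartition m M c) ⊆ (extChartAt (𝓡 m) c).source := by
  rw [extChartAt_source]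
  exact chartPartition_isSubordinate m M c

theorem finite_support_chartPartition :
    {c : M | (Function.support (chartPartition m M c)).Nonempty}.Finite :=
  (chartPartition m M).locallyFinite.finite_nonempty_of_compact

variable (m M) in
/-- The finite set of charts that contribute to the partition of unity. -/
def chartCenters : Finset M := (finite_support_chartPartition (m := m) (M := M)).toFinset

theorem chartPartition_eq_zero {c : M} (hc : c ∉ chartCenters m M) (x : M) :
    chartPartition m M c x = 0 := by
  by_contra h
  exact hc ((finite_support_chartPartition (m := m)).mem_toFinset.2 ⟨x, h⟩)

theorem sum_chartPartition (x : M) : ∑ c ∈ chartCenters m M, chartPartition m M c x = 1 := by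
  rw [← (chartPartition m M).sum_eq_one (mem_univ x)]
  refine (finsum_eq_sum_of_support_subset _ fun c hc => ?_).symm
  by_contra h
  exact hc (chartPartition_eq_zero h x)

/-- The density of the volume in the chart around `c`, weighted by the partition of unity. -/
def weightedDensity (c : M) (y : EuclideanSpace ℝ (Fin m)) : ℝ :=
  chartPartition m M c ((extChartAt (𝓡 m) c).symm y) * √(gram g c y).det

theorem weightedDensity_nonneg (c : M) (y : EuclideanSpace ℝ (Fin m)) :
    0 ≤ weightedDensity g c y :=
  mul_nonneg ((chartPartition m M).nonneg c _) (Real.sqrt_nonneg _)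

theorem integrableOn_weightedDensity (c : M) :
    IntegrableOn (weightedDensity g c) (extChartAt (𝓡 m) c).target :=
  integrableOn_target_of_tsupport_subset (chartPartition m M c).contMDiff.continuous
    (chartPartition_tsupport_subset c) (contDiffOn_sqrt_det_gram g c).continuousOn

theorem aemeasurable_weightedDensity (c : M) :
    AEMeasurable (fun y => ENNReal.ofReal (weightedDensity g c y))
      (volume.restrict (extChartAt (𝓡 m) c).target) :=
  (integrableOn_weightedDensity g c).aestronglyMeasurable.aemeasurable.ennreal_ofReal

variable [MeasurableSpace M]

/-- The contribution of the chart around `c` to the volume. -/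
def chartVol (c : M) : Measure M :=
  ((volume.restrict (extChartAt (𝓡 m) c).target).withDensity fun y =>
    ENNReal.ofReal (weightedDensity g c y)).map (extChartAt (𝓡 m) c).symm

/-- By compactness and local finiteness only finitely many members of the partition are nonzero. -/
theorem vol_eq_sum : vol g = ∑ c ∈ chartCenters m M, chartVol g c := by
  ext A hA
  rw [vol, Measure.sum_apply _ hA, Measure.finsetSum_apply]
  refine tsum_eq_sum fun c hc => ?_
  simp [chartPartition_eq_zero hc]

variable [BorelSpace M]

theorem aemeasurable_symm (c : M) :
    AEMeasurable (extChartAt (𝓡 m) c).symm ((volume.restrict (extChartAt (𝓡 m) c).target).withDensity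
      fun y => ENNReal.ofReal (weightedDensity g c y)) :=
  ((continuousOn_extChartAt_symm c).aemeasurable (isOpen_target c).measurableSet).mono_ac
    (withDensity_absolutelyContinuous _ _)

instance isFiniteMeasure_chartVol (c : M) : IsFiniteMeasure (chartVol g c) := by
  have : IsFiniteMeasure ((volume.restrict (extChartAt (𝓡 m) c).target).withDensity
      fun y => ENNReal.ofReal (weightedDensity g c y)) :=
    isFiniteMeasure_withDensity_ofReal (integrableOn_weightedDensity g c).2
  unfold chartVol
  infer_instance

instance isFiniteMeasure_vol : IsFiniteMeasure (vol g) := by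
  rw [vol_eq_sum]
  infer_instance

theorem integrable_of_continuous {μ : Measure M} [IsFiniteMeasure μ] {F : M → ℝ}
    (hF : Continuous F) : Integrable F μ :=
  hF.integrable_of_hasCompactSupport (HasCompactSupport.of_compactSpace F)

theorem integral_chartVol (c : M) {F : M → ℝ} (hF : Continuous F) :
    ∫ x, F x ∂(chartVol g c) = ∫ y in (extChartAt (𝓡 m) c).target,
      (chartPartition m M c ((extChartAt (𝓡 m) c).symm y) * F ((extChartAt (𝓡 m) c).symm y))
        * √(gram g c y).det := by
  rw [chartVol, integral_map (aemeasurable_symm g c) hF.aestronglyMeasurable,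
    integral_withDensity_eq_integral_toReal_smul₀ (aemeasurable_weightedDensity g c)
      (Filter.Eventually.of_forall fun _ => ENNReal.ofReal_lt_top)]
  refine integral_congr_ae (Filter.Eventually.of_forall fun y => ?_)
  simp only [ENNReal.toReal_ofReal (weightedDensity_nonneg g c y), smul_eq_mul]
  rw [weightedDensity]
  ring

theorem integral_vol_eq_sum {F : M → ℝ} (hF : Continuous F) :
    ∫ x, F x ∂(vol g) = ∑ c ∈ chartCenters m M, ∫ x, F x ∂(chartVol g c) := by
  rw [vol_eq_sum, integral_finsetSum_measure fun c _ => integrable_of_continuous hF]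

/-- Both integrals live on the overlap: in the chart around `c` because `F` vanishes outside it, in
the chart around `c'` because the partition function of `c` does. -/
theorem integral_chartVol_of_tsupport_subset (c c' : M) {F : M → ℝ} (hF : Continuous F)
    (hsupp : tsupport F ⊆ (extChartAt (𝓡 m) c').source) :
    ∫ x, F x ∂(chartVol g c) = ∫ y in (extChartAt (𝓡 m) c').target,
      (chartPartition m M c ((extChartAt (𝓡 m) c').symm y) * F ((extChartAt (𝓡 m) c').symm y))
        * √(gram g c' y).det := by
  rw [integral_chartVol g c hF]
  have h := setIntegral_overlap g c c' fun x => chartPartition m M c x * F x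
  rw [setIntegral_eq_of_subset_of_forall_sdiff_eq_zero (isOpen_target c).measurableSet
    (s := overlap c c') inter_subset_left, h]
  · refine (setIntegral_eq_of_subset_of_forall_sdiff_eq_zero (isOpen_target c').measurableSet
      inter_subset_left fun y hy => ?_).symm
    have : chartPartition m M c ((extChartAt (𝓡 m) c').symm y) = 0 :=
      image_eq_zero_of_notMem_tsupport fun h =>
        hy.2 ⟨hy.1, chartPartition_tsupport_subset c h⟩
    simp only [this, zero_mul]
  · intro y hy
    have : F ((extChartAt (𝓡 m) c).symm y) = 0 :=
      image_eq_zero_of_notMem_tsupport fun h => hy.2 ⟨hy.1, hsupp h⟩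
    simp only [this, zero_mul, mul_zero]

/-- The volume integral of a function supported in a chart. -/
theorem integral_vol_of_tsupport_subset (c : M) {F : M → ℝ} (hF : Continuous F)
    (hsupp : tsupport F ⊆ (extChartAt (𝓡 m) c).source) :
    ∫ x, F x ∂(vol g) = ∫ y in (extChartAt (𝓡 m) c).target,
      F ((extChartAt (𝓡 m) c).symm y) * √(gram g c y).det := by
  rw [integral_vol_eq_sum g hF]
  simp only [fun c' => integral_chartVol_of_tsupport_subset g c' c hF hsupp]
  rw [← integral_finsetSum]
  · refine integral_congr_ae (Filter.Eventually.of_forall fun y => ?_)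
    simp only [← Finset.sum_mul, sum_chartPartition, one_mul]
  · intro c' _
    exact integrableOn_target_of_tsupport_subset
      (w := fun x => chartPartition m M c' x * F x)
      ((chartPartition m M c').contMDiff.continuous.mul hF)
      ((tsupport_mul_subset_right).trans hsupp) (contDiffOn_sqrt_det_gram g c).continuousOn

instance isOpenPosMeasure_vol : (vol g).IsOpenPosMeasure := by
  refine ⟨fun U hU hne h0 => ?_⟩
  obtain ⟨x, hx⟩ := hne
  obtain ⟨c, hc, hcx⟩ : ∃ c ∈ chartCenters m M, chartPartition m M c x ≠ 0 := by
    by_contra! h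
    have := sum_chartPartition (m := m) x
    rw [Finset.sum_eq_zero h] at this
    exact zero_ne_one this
  have h1 : chartVol g c U = 0 := by
    rw [vol_eq_sum, Measure.finsetSum_apply] at h0
    exact (Finset.sum_eq_zero_iff.1 h0) c hc
  -- On this smaller open set the weighted density is strictly positive, so a null set for the
  -- volume would give a Lebesgue-null nonempty open set.
  set W := U ∩ Function.support (chartPartition m M c) with hW
  have hWo : IsOpen W :=
    hU.inter (chartPartition m M c).contMDiff.continuous.isOpen_support
  have h2 : chartVol g c W = 0 := measure_mono_null inter_subset_left h1
  set T := (extChartAt (𝓡 m) c).target with hT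
  set S := T ∩ (extChartAt (𝓡 m) c).symm ⁻¹' W with hS
  have hSo : IsOpen S := (continuousOn_extChartAt_symm c).isOpen_inter_preimage (isOpen_target c) hWo
  have hxs : x ∈ (extChartAt (𝓡 m) c).source :=
    chartPartition_tsupport_subset c (subset_tsupport _ hcx)
  have hSne : S.Nonempty := by
    refine ⟨extChartAt (𝓡 m) c x, (extChartAt (𝓡 m) c).map_source hxs, ?_⟩
    rw [mem_preimage, (extChartAt (𝓡 m) c).left_inv hxs]
    exact ⟨hx, hcx⟩
  rw [chartVol, Measure.map_apply_of_aemeasurable (aemeasurable_symm g c) hWo.measurableSet] at h2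
  have h3 : ((volume.restrict T).withDensity fun y => ENNReal.ofReal (weightedDensity g c y)) S = 0 :=
    measure_mono_null inter_subset_right h2
  rw [withDensity_apply _ hSo.measurableSet, Measure.restrict_restrict hSo.measurableSet,
    inter_eq_left.2 (inter_subset_left : S ⊆ T)] at h3
  rw [lintegral_eq_zero_iff' ((aemeasurable_weightedDensity g c).mono_measure
    (Measure.restrict_mono inter_subset_left le_rfl)), Filter.EventuallyEq,
    ae_restrict_iff' hSo.measurableSet] at h3
  have h4 : volume S = 0 := by
    refine measure_mono_null (fun y hy => ?_) (ae_iff.1 h3)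
    simp only [mem_ofPred_eq, Classical.not_imp, Pi.zero_apply, ENNReal.ofReal_eq_zero, not_le]
    exact ⟨hy, mul_pos (lt_of_le_of_ne ((chartPartition m M).nonneg c _) (Ne.symm hy.2.2))
      (Real.sqrt_pos.2 (gram_det_pos g c hy.1))⟩
  exact hSo.measure_ne_zero volume hSne h4

end VolumeMeasure

/-! ### Algebra and positivity of the gradient product. -/

section GradientAlgebra

open Topology Set

variable {m : ℕ} {M : Type*} [TopologicalSpace M] [ChartedSpace (EuclideanSpace ℝ (Fin m)) M]
  [IsManifold (𝓡 m) ∞ M] (g : Metr m M)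

theorem differentiableAt_chartRep {f : M → ℝ} (hf : ContMDiff (𝓡 m) 𝓘(ℝ, ℝ) ∞ f) (x : M) :
    DifferentiableAt ℝ (chartRep x f) (extChartAt (𝓡 m) x x) :=
  differentiableAt_of_contDiffOn x (contDiffOn_chartRep x hf) (mem_extChartAt_target x)

theorem gradInner_comm (f h : M → ℝ) (x : M) : gradInner g f h x = gradInner g h f x := by
  rw [gradInner, gradInner, chartGradInner, chartGradInner, Finset.sum_comm]
  refine Finset.sum_congr rfl fun i _ => Finset.sum_congr rfl fun j _ => ?_
  rw [gram_inv_symm g x _ j i]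
  ring

theorem gradInner_add_right (f : M → ℝ) {h k : M → ℝ} (hh : ContMDiff (𝓡 m) 𝓘(ℝ, ℝ) ∞ h)
    (hk : ContMDiff (𝓡 m) 𝓘(ℝ, ℝ) ∞ k) (x : M) :
    gradInner g f (fun z => h z + k z) x = gradInner g f h x + gradInner g f k x := by
  have h1 : ∀ j, partialD j (chartRep x fun z => h z + k z) (extChartAt (𝓡 m) x x)
      = partialD j (chartRep x h) (extChartAt (𝓡 m) x x)
        + partialD j (chartRep x k) (extChartAt (𝓡 m) x x) := fun j => by
    have := fderiv_fun_add (differentiableAt_chartRep hh x) (differentiableAt_chartRep hk x)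
    exact congrArg (fun L : EuclideanSpace ℝ (Fin m) →L[ℝ] ℝ =>
      L (EuclideanSpace.single j (1 : ℝ))) this
  simp only [gradInner, chartGradInner, h1, ← Finset.sum_add_distrib]
  refine Finset.sum_congr rfl fun i _ => Finset.sum_congr rfl fun j _ => ?_
  ring

theorem gradInner_mul_right (f : M → ℝ) {h k : M → ℝ} (hh : ContMDiff (𝓡 m) 𝓘(ℝ, ℝ) ∞ h)
    (hk : ContMDiff (𝓡 m) 𝓘(ℝ, ℝ) ∞ k) (x : M) :
    gradInner g f (fun z => h z * k z) x = h x * gradInner g f k x + k x * gradInner g f h x := by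
  have h1 : ∀ j, partialD j (chartRep x fun z => h z * k z) (extChartAt (𝓡 m) x x)
      = h x * partialD j (chartRep x k) (extChartAt (𝓡 m) x x)
        + k x * partialD j (chartRep x h) (extChartAt (𝓡 m) x x) := fun j => by
    have := fderiv_fun_mul (differentiableAt_chartRep hh x) (differentiableAt_chartRep hk x)
    simp only [chartRep, extChartAt_to_inv] at this
    exact congrArg (fun L : EuclideanSpace ℝ (Fin m) →L[ℝ] ℝ =>
      L (EuclideanSpace.single j (1 : ℝ))) this
  simp only [gradInner, chartGradInner, h1, ← Finset.sum_add_distrib, Finset.mul_sum]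
  refine Finset.sum_congr rfl fun i _ => Finset.sum_congr rfl fun j _ => ?_
  ring

theorem partialD_const {F : Type*} [NormedAddCommGroup F] [NormedSpace ℝ F] (i : Fin m) (a : F)
    (y : EuclideanSpace ℝ (Fin m)) : partialD i (fun _ => a) y = 0 := by
  simp [partialD]

theorem gradInner_const_right (f : M → ℝ) (a : ℝ) (x : M) :
    gradInner g f (fun _ => a) x = 0 := by
  have h1 : ∀ j, partialD j (chartRep x fun _ => a) (extChartAt (𝓡 m) x x) = 0 :=
    fun j => partialD_const j a _
  simp only [gradInner, chartGradInner, h1, mul_zero, Finset.sum_const_zero]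

theorem laplacian_const (a : ℝ) (x : M) : laplacian g (fun _ => a) x = 0 := by
  have h1 : ∀ j, partialD (m := m) j (chartRep x fun _ => a) = fun _ => 0 :=
    fun j => funext fun y => partialD_const j a y
  simp only [laplacian, chartLaplacian, h1, partialD_const, mul_zero, Finset.sum_const_zero,
    sub_zero]

theorem gradInner_sum_right {ι : Type*} (s : Finset ι) (f : M → ℝ) {h : ι → M → ℝ}
    (hh : ∀ a, ContMDiff (𝓡 m) 𝓘(ℝ, ℝ) ∞ (h a)) (x : M) :
    gradInner g f (fun z => ∑ a ∈ s, h a z) x = ∑ a ∈ s, gradInner g f (h a) x := by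
  classical
  induction s using Finset.induction_on with
  | empty => simpa using gradInner_const_right g f 0 x
  | insert a s ha ih =>
    simp only [Finset.sum_insert ha]
    rw [gradInner_add_right g f (hh a) (contMDiff_finsetSum fun b _ => hh b), ih]

theorem gradInner_self_nonneg (f : M → ℝ) (x : M) : 0 ≤ gradInner g f f x := by
  rw [gradInner, chartGradInner_eq_dotProduct]
  have h := (gram_posDef g x (mem_extChartAt_target (I := 𝓡 m) x)).inv.posSemidef
  simpa using h.dotProduct_mulVec_nonneg
    fun i => partialD i (chartRep x f) (extChartAt (𝓡 m) x x)

theorem fderiv_eq_zero_of_partialD {F : Type*} [NormedAddCommGroup F] [NormedSpace ℝ F]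
    {f : EuclideanSpace ℝ (Fin m) → F} {y : EuclideanSpace ℝ (Fin m)}
    (h : ∀ i, partialD i f y = 0) : fderiv ℝ f y = 0 := by
  ext v
  have hv : v = ∑ i, v i • EuclideanSpace.single i (1 : ℝ) := by
    ext j
    simp [Pi.single_apply]
  rw [hv, map_sum]
  simp only [map_smul]
  exact Finset.sum_eq_zero fun i _ => by
    rw [show fderiv ℝ f y (EuclideanSpace.single i (1 : ℝ)) = 0 from h i, smul_zero]

theorem partialD_eq_zero_of_chartGradInner_self (c : M) {f : M → ℝ}
    {y : EuclideanSpace ℝ (Fin m)} (hy : y ∈ (extChartAt (𝓡 m) c).target)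
    (h : chartGradInner g c f f y = 0) (i : Fin m) : partialD i (chartRep c f) y = 0 := by
  by_contra hi
  have hpos := (gram_posDef g c hy).inv.dotProduct_mulVec_pos
    (x := fun i => partialD i (chartRep c f) y) fun h0 => hi (congrFun h0 i)
  rw [chartGradInner_eq_dotProduct] at h
  simp [h] at hpos

/-- Positive definiteness kills all partial derivatives, so `f` is constant on a ball in each chart,
hence locally constant. -/
theorem eq_of_gradInner_self_eq_zero [PreconnectedSpace M] {f : M → ℝ}
    (hf : ContMDiff (𝓡 m) 𝓘(ℝ, ℝ) ∞ f) (h : ∀ x, gradInner g f f x = 0) (x y : M) :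
    f x = f y := by
  refine IsLocallyConstant.apply_eq_of_preconnectedSpace
    ((IsLocallyConstant.iff_eventually_eq f).2 fun c => ?_) x y
  obtain ⟨ε, hε, hball⟩ := Metric.isOpen_iff.1 (isOpen_target c) _
    (mem_extChartAt_target (I := 𝓡 m) c)
  have hc : ∀ᶠ z in 𝓝 c, extChartAt (𝓡 m) c z ∈ Metric.ball (extChartAt (𝓡 m) c c) ε :=
    (continuousAt_extChartAt c).eventually (Metric.ball_mem_nhds _ hε)
  filter_upwards [hc, extChartAt_source_mem_nhds (I := 𝓡 m) c] with z hz hzs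
  have := Metric.isOpen_ball.is_const_of_fderiv_eq_zero (𝕜 := ℝ) (f := chartRep c f)
    (convex_ball _ _).isPreconnected
    (fun w hw => (differentiableAt_of_contDiffOn c (contDiffOn_chartRep c hf)
      (hball hw)).differentiableWithinAt)
    (fun w hw => fderiv_eq_zero_of_partialD fun i =>
      partialD_eq_zero_of_chartGradInner_self g c (hball hw)
        (by rw [← gradInner_symm_apply g c (hball hw) hf hf, h]) i) hz (Metric.mem_ball_self hε)
  rwa [chartRep, chartRep, (extChartAt (𝓡 m) c).left_inv hzs, extChartAt_to_inv] at this

theorem tsupport_gradInner_subset (f h : M → ℝ) : tsupport (gradInner g f h) ⊆ tsupport h := by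
  refine closure_minimal (fun x hx => ?_) (isClosed_tsupport h)
  by_contra hxs
  refine hx ?_
  have hev : chartRep x h =ᶠ[𝓝 (extChartAt (𝓡 m) x x)] fun _ => 0 := by
    have h1 : ∀ᶠ z in 𝓝 ((extChartAt (𝓡 m) x).symm (extChartAt (𝓡 m) x x)), h z = 0 := by
      rw [extChartAt_to_inv]
      exact notMem_tsupport_iff_eventuallyEq.1 hxs
    exact (continuousAt_extChartAt_symm x).eventually h1
  have h1 : ∀ j, partialD j (chartRep x h) (extChartAt (𝓡 m) x x) = 0 := fun j => by
    rw [partialD, hev.fderiv_eq]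
    simp
  simp only [gradInner, chartGradInner, h1, mul_zero, Finset.sum_const_zero]

end GradientAlgebra

/-! ### Green's formula and the chart independence of the Laplacian. -/

section Green

open Topology Set

theorem integrableOn_and_integral_fderiv_eq_zero {V : Type*} [NormedAddCommGroup V]
    [NormedSpace ℝ V] [FiniteDimensional ℝ V] [MeasurableSpace V] [BorelSpace V] (μ : Measure V)
    [μ.IsAddHaarMeasure] {T K : Set V} (hT : IsOpen T) (hK : IsCompact K) (hKT : K ⊆ T)
    {u : V → ℝ} (hu : ContDiffOn ℝ ∞ u T) (h0 : ∀ y ∈ T, y ∉ K → u y = 0) (v : V) :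
    IntegrableOn (fun y => fderiv ℝ u y v) T μ ∧ ∫ y in T, fderiv ℝ u y v ∂μ = 0 := by
  -- Extension by zero: it is smooth on the whole space because `u` already vanishes off the compact
  -- set `K` inside `T`.
  set u0 := T.indicator u with hu0
  have hout : ∀ y, y ∉ K → u0 =ᶠ[𝓝 y] fun _ => 0 := fun y hy => by
    filter_upwards [hK.isClosed.isOpen_compl.mem_nhds hy] with z hz
    by_cases hzT : z ∈ T
    · rw [hu0, indicator_of_mem hzT, h0 z hzT hz]
    · rw [hu0, indicator_of_notMem hzT]
  have hin : ∀ y ∈ T, u0 =ᶠ[𝓝 y] u := fun y hy => by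
    filter_upwards [hT.mem_nhds hy] with z hz
    rw [hu0, indicator_of_mem hz]
  have hsm : ContDiff ℝ ∞ u0 := contDiff_iff_contDiffAt.2 fun y => by
    by_cases hy : y ∈ T
    · exact (hu.contDiffAt (hT.mem_nhds hy)).congr_of_eventuallyEq (hin y hy)
    · exact contDiffAt_const.congr_of_eventuallyEq (hout y fun h => hy (hKT h))
  have hcs : HasCompactSupport u0 := HasCompactSupport.intro hK fun y hy => (hout y hy).eq_of_nhds
  have hcs' : HasCompactSupport fun y => fderiv ℝ u0 y v := hcs.fderiv_apply ℝ v
  have hcont : Continuous fun y => fderiv ℝ u0 y v :=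
    (hsm.continuous_fderiv (by simp)).clm_apply continuous_const
  have hint : Integrable (fun y => fderiv ℝ u0 y v) μ := hcont.integrable_of_hasCompactSupport hcs'
  have heq : EqOn (fun y => fderiv ℝ u0 y v) (fun y => fderiv ℝ u y v) T := fun y hy => by
    simp only [(hin y hy).fderiv_eq]
  refine ⟨hint.integrableOn.congr_fun heq hT.measurableSet, ?_⟩
  rw [← setIntegral_congr_fun hT.measurableSet heq,
    setIntegral_eq_integral_of_forall_compl_eq_zero]
  -- Integration by parts against the constant function `1`.
  · have := integral_mul_fderiv_eq_neg_fderiv_mul_of_integrable (μ := μ) (f := fun _ => (1 : ℝ))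
      (g := u0) (v := v) (by simp) (by simpa using hint)
      (by simpa using hsm.continuous.integrable_of_hasCompactSupport hcs)
      (fun _ _ => differentiableAt_const _) (fun y _ => hsm.differentiable (by simp) y)
    simpa using this
  · intro y hy
    rw [(hout y fun h => hy (hKT h)).fderiv_eq]
    simp

variable {m : ℕ} {M : Type*} [TopologicalSpace M] [ChartedSpace (EuclideanSpace ℝ (Fin m)) M]
  [IsManifold (𝓡 m) ∞ M] (g : Metr m M)

theorem continuous_mul_chart_of_tsupport_subset (c : M) {h : M → ℝ} (hh : Continuous h)
    (hsupp : tsupport h ⊆ (extChartAt (𝓡 m) c).source) {q : EuclideanSpace ℝ (Fin m) → ℝ}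
    (hq : ContinuousOn q (extChartAt (𝓡 m) c).target) :
    Continuous fun x => h x * q (extChartAt (𝓡 m) c x) := by
  refine continuous_of_tsupport fun x hx => ?_
  have hxs := hsupp ((tsupport_mul_subset_left) hx)
  refine hh.continuousAt.mul (ContinuousAt.comp ?_ (continuousAt_extChartAt' hxs))
  exact hq.continuousAt ((isOpen_target c).mem_nhds ((extChartAt (𝓡 m) c).map_source hxs))

variable [CompactSpace M] [T2Space M] [MeasurableSpace M] [BorelSpace M]

/-- Green's formula for a test function supported in a chart. -/
theorem integral_mul_chartLaplacian (c : M) {f h : M → ℝ} (hf : ContMDiff (𝓡 m) 𝓘(ℝ, ℝ) ∞ f)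
    (hh : ContMDiff (𝓡 m) 𝓘(ℝ, ℝ) ∞ h) (hsupp : tsupport h ⊆ (extChartAt (𝓡 m) c).source) :
    ∫ x, h x * chartLaplacian g c f (extChartAt (𝓡 m) c x) ∂(vol g)
      = - ∫ x, gradInner g f h x ∂(vol g) := by
  have hT := (isOpen_target (m := m) c)
  have hD := (contMDiff_gradInner g hf hh).continuous
  have hL := (contDiffOn_chartLaplacian g c hf).continuousOn
  have hs := (contDiffOn_sqrt_det_gram g c).continuousOn
  have hDs : tsupport (gradInner g f h) ⊆ (extChartAt (𝓡 m) c).source :=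
    (tsupport_gradInner_subset g f h).trans hsupp
  rw [eq_neg_iff_add_eq_zero,
    integral_vol_of_tsupport_subset g c
      (continuous_mul_chart_of_tsupport_subset c hh.continuous hsupp hL)
      ((tsupport_mul_subset_left).trans hsupp),
    integral_vol_of_tsupport_subset g c hD hDs, ← integral_add]
  -- Each flux component carries the factor `h`, so it vanishes off the compact image of the support
  -- of `h`, and its derivatives integrate to zero.
  · have hflux := fun i => integrableOn_and_integral_fderiv_eq_zero volume hT
      (K := extChartAt (𝓡 m) c '' tsupport h)
      ((isClosed_tsupport h).isCompact.image_of_continuousOn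
        ((continuousOn_extChartAt c).mono hsupp))
      (by rintro _ ⟨x, hx, rfl⟩; exact (extChartAt (𝓡 m) c).map_source (hsupp hx))
      (contDiffOn_fluxComponent g c hf hh i) (fun y hy hyK => by
        have : chartRep c h y = 0 := image_eq_zero_of_notMem_tsupport (f := h) fun hz =>
          hyK ⟨_, hz, (extChartAt (𝓡 m) c).right_inv hy⟩
        simp [fluxComponent, this]) (EuclideanSpace.single i (1 : ℝ))
    have hzero : ∫ y in (extChartAt (𝓡 m) c).target,
        ∑ i, partialD i (fluxComponent g c f h i) y = 0 := by
      simp only [partialD]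
      rw [integral_finsetSum _ fun i _ => (hflux i).1]
      exact Finset.sum_eq_zero fun i _ => (hflux i).2
    rw [← hzero]
    refine setIntegral_congr_fun hT.measurableSet fun y hy => ?_
    rw [sum_partialD_fluxComponent g c hf hh hy, (extChartAt (𝓡 m) c).right_inv hy,
      gradInner_symm_apply g c hy hf hh, chartRep]
    ring
  · refine (integrableOn_target_of_tsupport_subset hh.continuous hsupp (hL.mul hs)).congr_fun
      (fun y hy => ?_) hT.measurableSet
    simp only [(extChartAt (𝓡 m) c).right_inv hy, Pi.mul_apply]
    ring
  · exact integrableOn_target_of_tsupport_subset hD hDs hs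

/-- A weak argument replaces the transformation law of Christoffel symbols. The right-hand side of
the local Green formula does not mention the chart, so the two expressions have equal integrals
against every test function supported in the overlap. They are continuous and the volume charges
open sets, so they agree everywhere there. -/
theorem chartLaplacian_eq_of_mem {c c' x : M} {f : M → ℝ} (hf : ContMDiff (𝓡 m) 𝓘(ℝ, ℝ) ∞ f)
    (hx : x ∈ (extChartAt (𝓡 m) c).source) (hx' : x ∈ (extChartAt (𝓡 m) c').source) :
    chartLaplacian g c f (extChartAt (𝓡 m) c x) = chartLaplacian g c' f (extChartAt (𝓡 m) c' x) := by
  set U := (extChartAt (𝓡 m) c).source ∩ (extChartAt (𝓡 m) c').source with hU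
  have hUo : IsOpen U := (isOpen_source c).inter (isOpen_source c')
  have hc : ∀ c : M, ContinuousOn (fun x => chartLaplacian g c f (extChartAt (𝓡 m) c x))
      (extChartAt (𝓡 m) c).source := fun c =>
    (contDiffOn_chartLaplacian g c hf).continuousOn.comp (continuousOn_extChartAt c)
      (extChartAt (𝓡 m) c).mapsTo
  have hcU := (hc c).mono (inter_subset_left : U ⊆ _)
  have hcU' := (hc c').mono (inter_subset_right : U ⊆ _)
  have hae : ∀ᵐ z ∂(vol g), z ∈ U → chartLaplacian g c f (extChartAt (𝓡 m) c z)
      - chartLaplacian g c' f (extChartAt (𝓡 m) c' z) = 0 := by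
    refine hUo.ae_eq_zero_of_integral_contMDiff_smul_eq_zero (𝓡 m)
      ((hcU.sub hcU').locallyIntegrableOn hUo.measurableSet) fun h hh _ hsupp => ?_
    have hs := hsupp.trans (inter_subset_left : U ⊆ _)
    have hs' := hsupp.trans (inter_subset_right : U ⊆ _)
    simp only [smul_eq_mul, mul_sub]
    rw [integral_sub, integral_mul_chartLaplacian g c hf hh hs,
      integral_mul_chartLaplacian g c' hf hh hs', sub_self]
    · exact integrable_of_continuous (continuous_mul_chart_of_tsupport_subset c hh.continuous hs
        (contDiffOn_chartLaplacian g c hf).continuousOn)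
    · exact integrable_of_continuous (continuous_mul_chart_of_tsupport_subset c' hh.continuous hs'
        (contDiffOn_chartLaplacian g c' hf).continuousOn)
  refine Measure.eqOn_open_of_ae_eq (μ := vol g) ?_ hUo hcU hcU' ⟨hx, hx'⟩
  rw [Filter.EventuallyEq, ae_restrict_iff' hUo.measurableSet]
  filter_upwards [hae] with z hz hzU
  exact sub_eq_zero.1 (hz hzU)

theorem laplacian_symm_apply (c : M) {y : EuclideanSpace ℝ (Fin m)}
    (hy : y ∈ (extChartAt (𝓡 m) c).target) {f : M → ℝ} (hf : ContMDiff (𝓡 m) 𝓘(ℝ, ℝ) ∞ f) :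
    laplacian g f ((extChartAt (𝓡 m) c).symm y) = chartLaplacian g c f y := by
  rw [laplacian, chartLaplacian_eq_of_mem g hf (mem_extChartAt_source _)
    ((extChartAt (𝓡 m) c).map_target hy), (extChartAt (𝓡 m) c).right_inv hy]

theorem laplacian_eq_chartLaplacian (c : M) {x : M} (hx : x ∈ (extChartAt (𝓡 m) c).source)
    {f : M → ℝ} (hf : ContMDiff (𝓡 m) 𝓘(ℝ, ℝ) ∞ f) :
    laplacian g f x = chartLaplacian g c f (extChartAt (𝓡 m) c x) :=
  chartLaplacian_eq_of_mem g hf (mem_extChartAt_source x) hx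

theorem IsSmoothFamily.laplacian {F : ℝ → M → ℝ} (hF : IsSmoothFamily m F) :
    IsSmoothFamily m (fun t => laplacian g (F t)) :=
  .of_contDiffOn fun c => (hF.contDiffOn_chartLaplacian g c).congr fun p hp =>
    laplacian_symm_apply g c hp.2 (hF.slice p.1)

theorem contMDiff_laplacian {f : M → ℝ} (hf : ContMDiff (𝓡 m) 𝓘(ℝ, ℝ) ∞ f) :
    ContMDiff (𝓡 m) 𝓘(ℝ, ℝ) ∞ (laplacian g f) :=
  ((IsSmoothFamily.const hf).laplacian g).slice 0

/-- **Green's formula** on a closed Riemannian manifold. -/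
theorem integral_mul_laplacian {f h : M → ℝ} (hf : ContMDiff (𝓡 m) 𝓘(ℝ, ℝ) ∞ f)
    (hh : ContMDiff (𝓡 m) 𝓘(ℝ, ℝ) ∞ h) :
    ∫ x, h x * laplacian g f x ∂(vol g) = - ∫ x, gradInner g f h x ∂(vol g) := by
  -- The partition of unity splits the test function `h`, not `f`, because the local formula
  -- requires only `h` to be supported in a chart.
  have hχ : ∀ c : M, ContMDiff (𝓡 m) 𝓘(ℝ, ℝ) ∞ fun x => chartPartition m M c x * h x := fun c =>
    (chartPartition m M c).contMDiff.mul hh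
  have hsum : ∀ x, h x = ∑ c ∈ chartCenters m M, chartPartition m M c x * h x := fun x => by
    rw [← Finset.sum_mul, sum_chartPartition, one_mul]
  have hint : ∀ c : M, Integrable
      (fun x => (chartPartition m M c x * h x) * laplacian g f x) (vol g) := fun c =>
    integrable_of_continuous ((hχ c).continuous.mul (contMDiff_laplacian g hf).continuous)
  have e1 : ∫ x, h x * laplacian g f x ∂(vol g) = ∑ c ∈ chartCenters m M,
      ∫ x, (chartPartition m M c x * h x) * laplacian g f x ∂(vol g) := by
    rw [← integral_finsetSum _ fun c _ => hint c]
    refine integral_congr_ae (Filter.Eventually.of_forall fun x => ?_)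
    simp only
    rw [← Finset.sum_mul, ← hsum]
  have e2 : ∫ x, gradInner g f h x ∂(vol g) = ∑ c ∈ chartCenters m M,
      ∫ x, gradInner g f (fun z => chartPartition m M c z * h z) x ∂(vol g) := by
    rw [← integral_finsetSum _ fun c _ => integrable_of_continuous
      (contMDiff_gradInner g hf (hχ c)).continuous]
    refine integral_congr_ae (Filter.Eventually.of_forall fun x => ?_)
    simp only
    rw [← gradInner_sum_right g _ f hχ]
    simp only [← hsum]
  rw [e1, e2, ← Finset.sum_neg_distrib]
  refine Finset.sum_congr rfl fun c _ => ?_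
  have hs : tsupport (fun x => chartPartition m M c x * h x) ⊆ (extChartAt (𝓡 m) c).source :=
    (tsupport_mul_subset_left).trans (chartPartition_tsupport_subset c)
  rw [← integral_mul_chartLaplacian g c hf (hχ c) hs]
  refine integral_congr_ae (Filter.Eventually.of_forall fun x => ?_)
  simp only
  by_cases hx : x ∈ (extChartAt (𝓡 m) c).source
  · rw [laplacian_eq_chartLaplacian g c hx hf]
  · have : chartPartition m M c x * h x = 0 :=
      image_eq_zero_of_notMem_tsupport (f := fun x => chartPartition m M c x * h x)
        fun h' => hx (hs h')
    rw [this, zero_mul, zero_mul]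

end Green

/-! ### Maps into spheres in ambient coordinates. -/

section SphereValued

open Topology Set

theorem contMDiff_of_coord {E' : Type*} [NormedAddCommGroup E'] [NormedSpace ℝ E'] {H' : Type*}
    [TopologicalSpace H'] {J : ModelWithCorners ℝ E' H'} {X : Type*} [TopologicalSpace X]
    [ChartedSpace H' X] {k : ℕ} {f : X → EuclideanSpace ℝ (Fin k)}
    (hf : ∀ a, ContMDiff J 𝓘(ℝ, ℝ) ∞ fun x => f x a) :
    ContMDiff J 𝓘(ℝ, EuclideanSpace ℝ (Fin k)) ∞ f :=
  (EuclideanSpace.equiv (Fin k) ℝ).symm.contDiff.contMDiff.comp (contMDiff_pi_space.2 hf)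

theorem contMDiff_coord {E' : Type*} [NormedAddCommGroup E'] [NormedSpace ℝ E'] {H' : Type*}
    [TopologicalSpace H'] {J : ModelWithCorners ℝ E' H'} {X : Type*} [TopologicalSpace X]
    [ChartedSpace H' X] {k : ℕ} {f : X → EuclideanSpace ℝ (Fin k)}
    (hf : ContMDiff J 𝓘(ℝ, EuclideanSpace ℝ (Fin k)) ∞ f) (a : Fin k) :
    ContMDiff J 𝓘(ℝ, ℝ) ∞ fun x => f x a :=
  (EuclideanSpace.proj (𝕜 := ℝ) a).contDiff.contMDiff.comp hf

variable {m : ℕ} {M : Type*} [TopologicalSpace M] [ChartedSpace (EuclideanSpace ℝ (Fin m)) M]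

/-- The coordinates of a map into a sphere, in the Euclidean space that contains the sphere. -/
def coordFn {N : ℕ} {ρ : ℝ} (φ : M → Sph N ρ) (a : Fin (N + 1)) (x : M) : ℝ :=
  (φ x : EuclideanSpace ℝ (Fin (N + 1))) a

variable {N : ℕ} {ρ : ℝ}

theorem sum_sq_of_mem_sphere (p : Sph N ρ) :
    ∑ a, (p : EuclideanSpace ℝ (Fin (N + 1))) a * (p : EuclideanSpace ℝ (Fin (N + 1))) a
      = ρ ^ 2 := by
  have h : ‖(p : EuclideanSpace ℝ (Fin (N + 1)))‖ ^ 2 = ρ ^ 2 := by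
    rw [mem_sphere_zero_iff_norm.1 p.2]
  rw [EuclideanSpace.norm_sq_eq] at h
  simpa [← pow_two] using h

theorem sum_coordFn_sq (φ : M → Sph N ρ) (x : M) :
    ∑ a, coordFn φ a x * coordFn φ a x = ρ ^ 2 :=
  sum_sq_of_mem_sphere (φ x)

theorem IsSmooth.coordFn {φ : M → Sph N ρ} (hφ : IsSmooth m φ) (a : Fin (N + 1)) :
    ContMDiff (𝓡 m) 𝓘(ℝ, ℝ) ∞ (coordFn φ a) :=
  contMDiff_coord hφ a

theorem IsSmooth.of_coordFn {φ : M → Sph N ρ}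
    (hφ : ∀ a, ContMDiff (𝓡 m) 𝓘(ℝ, ℝ) ∞ (SphereMaps.coordFn φ a)) : IsSmooth m φ :=
  contMDiff_of_coord hφ

variable [IsManifold (𝓡 m) ∞ M]

theorem contDiffOn_localRep {φ : M → Sph N ρ} (hφ : IsSmooth m φ) (c : M) :
    ContDiffOn ℝ ∞ (localRep φ c) (extChartAt (𝓡 m) c).target := by
  rw [← contMDiffOn_iff_contDiffOn]
  exact ContMDiff.comp_contMDiffOn
    (g := fun x : M => (φ x : EuclideanSpace ℝ (Fin (N + 1)))) hφ (contMDiffOn_extChartAt_symm c)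

theorem partialD_apply {k : ℕ} {f : EuclideanSpace ℝ (Fin m) → EuclideanSpace ℝ (Fin k)}
    {y : EuclideanSpace ℝ (Fin m)} (hf : DifferentiableAt ℝ f y) (i : Fin m) (a : Fin k) :
    partialD i f y a = partialD i (fun z => f z a) y := by
  have h := ((EuclideanSpace.proj (𝕜 := ℝ) a).hasFDerivAt.comp y hf.hasFDerivAt).fderiv
  exact (congrArg (fun L : EuclideanSpace ℝ (Fin m) →L[ℝ] ℝ =>
    L (EuclideanSpace.single i (1 : ℝ))) h).symm

theorem partialD_localRep_apply {φ : M → Sph N ρ} (hφ : IsSmooth m φ) (c : M)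
    {y : EuclideanSpace ℝ (Fin m)} (hy : y ∈ (extChartAt (𝓡 m) c).target) (i : Fin m)
    (a : Fin (N + 1)) :
    partialD i (localRep φ c) y a = partialD i (chartRep c (coordFn φ a)) y :=
  partialD_apply (differentiableAt_of_contDiffOn c (contDiffOn_localRep hφ c) hy) i a

theorem partialD_partialD_localRep_apply {φ : M → Sph N ρ} (hφ : IsSmooth m φ) (c : M)
    {y : EuclideanSpace ℝ (Fin m)} (hy : y ∈ (extChartAt (𝓡 m) c).target) (i j : Fin m)
    (a : Fin (N + 1)) : partialD i (partialD j (localRep φ c)) y a =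
      partialD i (partialD j (chartRep c (coordFn φ a))) y := by
  have hsm : ContDiffOn ℝ ∞ (partialD j (localRep φ c)) (extChartAt (𝓡 m) c).target :=
    contDiffOn_fderiv_apply_const (isOpen_target c) (contDiffOn_localRep hφ c) _
  rw [partialD_apply (differentiableAt_of_contDiffOn c hsm hy)]
  have hev : (fun z => partialD j (localRep φ c) z a) =ᶠ[𝓝 y]
      partialD j (chartRep c (coordFn φ a)) := by
    filter_upwards [(isOpen_target c).mem_nhds hy] with z hz
    exact partialD_localRep_apply hφ c hz j a
  rw [partialD, hev.fderiv_eq]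
  rfl

/-- First derivative of `|φ|² = ρ²`. -/
theorem sum_coordFn_mul_partialD {φ : M → Sph N ρ} (hφ : IsSmooth m φ) (c : M)
    {y : EuclideanSpace ℝ (Fin m)} (hy : y ∈ (extChartAt (𝓡 m) c).target) (j : Fin m) :
    ∑ a, chartRep c (coordFn φ a) y * partialD j (chartRep c (coordFn φ a)) y = 0 := by
  have h1 : HasDerivAt (fun s : ℝ => ∑ a,
      chartRep c (coordFn φ a) (y + s • EuclideanSpace.single j (1 : ℝ)) *
        chartRep c (coordFn φ a) (y + s • EuclideanSpace.single j (1 : ℝ)))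
      (∑ a, (partialD j (chartRep c (coordFn φ a)) y * chartRep c (coordFn φ a) y
        + chartRep c (coordFn φ a) y * partialD j (chartRep c (coordFn φ a)) y)) 0 := by
    refine HasDerivAt.fun_sum fun a _ => ?_
    have h := hasDerivAt_partialD
      (differentiableAt_of_contDiffOn c (contDiffOn_chartRep c (hφ.coordFn a)) hy) j
    have h' := h.mul h
    simp only [zero_smul, add_zero] at h'
    exact h'
  have h2 : (fun s : ℝ => ∑ a,
      chartRep c (coordFn φ a) (y + s • EuclideanSpace.single j (1 : ℝ)) *
        chartRep c (coordFn φ a) (y + s • EuclideanSpace.single j (1 : ℝ))) = fun _ => ρ ^ 2 :=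
    funext fun s => sum_coordFn_sq φ _
  rw [h2] at h1
  have h3 := h1.unique (hasDerivAt_const _ _)
  simp only [mul_comm (partialD j _ _), ← two_mul, ← Finset.mul_sum] at h3
  simpa using h3

/-- Derivative of the orthogonality relation `⟨φ, ∂ⱼφ⟩ = 0`. -/
theorem sum_coordFn_mul_partialD_partialD {φ : M → Sph N ρ} (hφ : IsSmooth m φ)
    (c : M) {y : EuclideanSpace ℝ (Fin m)} (hy : y ∈ (extChartAt (𝓡 m) c).target)
    (i j : Fin m) :
    ∑ a, chartRep c (coordFn φ a) y * partialD i (partialD j (chartRep c (coordFn φ a))) y =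
      - ∑ a, partialD i (chartRep c (coordFn φ a)) y * partialD j (chartRep c (coordFn φ a)) y := by
  have h1 : HasDerivAt (fun s : ℝ => ∑ a,
      chartRep c (coordFn φ a) (y + s • EuclideanSpace.single i (1 : ℝ)) *
        partialD j (chartRep c (coordFn φ a)) (y + s • EuclideanSpace.single i (1 : ℝ)))
      (∑ a, (partialD i (chartRep c (coordFn φ a)) y * partialD j (chartRep c (coordFn φ a)) y
        + chartRep c (coordFn φ a) y * partialD i (partialD j (chartRep c (coordFn φ a))) y)) 0 := by
    refine HasDerivAt.fun_sum fun a _ => ?_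
    have hs := contDiffOn_chartRep c (hφ.coordFn a)
    have h := (hasDerivAt_partialD (differentiableAt_of_contDiffOn c hs hy) i).mul
      (hasDerivAt_partialD (differentiableAt_of_contDiffOn c (contDiffOn_partialD c hs j) hy) i)
    simp only [zero_smul, add_zero] at h
    exact h
  have h2 : (fun s : ℝ => ∑ a,
      chartRep c (coordFn φ a) (y + s • EuclideanSpace.single i (1 : ℝ)) *
        partialD j (chartRep c (coordFn φ a)) (y + s • EuclideanSpace.single i (1 : ℝ)))
        =ᶠ[𝓝 0] fun _ => 0 := by
    have hc : ContinuousAt (fun s : ℝ => y + s • EuclideanSpace.single i (1 : ℝ)) 0 := by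
      fun_prop
    filter_upwards [hc.eventually ((isOpen_target c).mem_nhds (by simpa using hy))] with s hs
    exact sum_coordFn_mul_partialD hφ c hs j
  have h3 := h1.unique ((hasDerivAt_const (0 : ℝ) _).congr_of_eventuallyEq h2)
  rw [Finset.sum_add_distrib] at h3
  linarith

variable (g : Metr m M)

/-- The squared norm `|dφ|²` of the differential of a map into a sphere. -/
def normSqDifferential (φ : M → Sph N ρ) (x : M) : ℝ :=
  ∑ a, gradInner g (coordFn φ a) (coordFn φ a) x

theorem contMDiff_normSqDifferential {φ : M → Sph N ρ} (hφ : IsSmooth m φ) :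
    ContMDiff (𝓡 m) 𝓘(ℝ, ℝ) ∞ (normSqDifferential g φ) :=
  contMDiff_finsetSum fun a _ => contMDiff_gradInner g (hφ.coordFn a) (hφ.coordFn a)

theorem normSqDifferential_eq_sum (φ : M → Sph N ρ) (x : M) :
    normSqDifferential g φ x = ∑ i, ∑ j, (gram g x (extChartAt (𝓡 m) x x))⁻¹ i j *
      ∑ a, partialD i (chartRep x (coordFn φ a)) (extChartAt (𝓡 m) x x) *
        partialD j (chartRep x (coordFn φ a)) (extChartAt (𝓡 m) x x) := by
  simp only [normSqDifferential, gradInner, chartGradInner, Finset.mul_sum]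
  rw [Finset.sum_comm]
  refine Finset.sum_congr rfl fun i _ => ?_
  rw [Finset.sum_comm]

theorem energyDensity_eq {φ : M → Sph N ρ} (hφ : IsSmooth m φ) (x : M) :
    energyDensity g φ x = (1 / 2) * normSqDifferential g φ x := by
  rw [energyDensity, normSqDifferential_eq_sum]
  congr 1
  refine Finset.sum_congr rfl fun i _ => Finset.sum_congr rfl fun j _ => ?_
  congr 1
  simp only [PiLp.inner_apply, partialD_localRep_apply hφ x (mem_extChartAt_target x)]
  refine Finset.sum_congr rfl fun a _ => ?_
  simp [mul_comm]

/-- In the trace, the Christoffel terms are orthogonal to `φ` and the second derivatives pair with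
`φ` to `-⟨∂ᵢφ, ∂ⱼφ⟩`. -/
theorem sum_coordFn_mul_laplacian {φ : M → Sph N ρ} (hφ : IsSmooth m φ) (x : M) :
    ∑ a, coordFn φ a x * laplacian g (coordFn φ a) x = - normSqDifferential g φ x := by
  have hy := mem_extChartAt_target (I := 𝓡 m) x
  have h1 := fun j => sum_coordFn_mul_partialD hφ x hy j
  have h2 := fun i j => sum_coordFn_mul_partialD_partialD hφ x hy i j
  simp only [chartRep, extChartAt_to_inv] at h1 h2
  have e : ∀ a, coordFn φ a x * laplacian g (coordFn φ a) x =
      ∑ i, ∑ j, (gram g x (extChartAt (𝓡 m) x x))⁻¹ i j *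
        (coordFn φ a x * partialD i (partialD j (chartRep x (coordFn φ a))) (extChartAt (𝓡 m) x x)
        - ∑ k, christoffel g x (extChartAt (𝓡 m) x x) k i j *
          (coordFn φ a x * partialD k (chartRep x (coordFn φ a)) (extChartAt (𝓡 m) x x))) := by
    intro a
    simp only [laplacian, chartLaplacian, Finset.mul_sum, mul_sub]
    refine Finset.sum_congr rfl fun i _ => Finset.sum_congr rfl fun j _ => ?_
    congr 1
    · ring
    · exact Finset.sum_congr rfl fun k _ => by ring
  simp only [e]
  rw [Finset.sum_comm, normSqDifferential_eq_sum, ← Finset.sum_neg_distrib]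
  refine Finset.sum_congr rfl fun i _ => ?_
  rw [Finset.sum_comm, ← Finset.sum_neg_distrib]
  refine Finset.sum_congr rfl fun j _ => ?_
  rw [← Finset.mul_sum, Finset.sum_sub_distrib, Finset.sum_comm]
  simp only [← Finset.mul_sum]
  simp only [h1, h2, mul_zero, Finset.sum_const_zero, sub_zero, mul_neg]

theorem starProjection_orthogonal_span_singleton_apply {k : ℕ} (p v : EuclideanSpace ℝ (Fin k))
    (a : Fin k) : (Submodule.span ℝ {p})ᗮ.starProjection v a
      = v a - inner ℝ p v / ‖p‖ ^ 2 * p a := by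
  rw [Submodule.starProjection_orthogonal']
  simp [Submodule.starProjection_singleton]

/-- Projecting to the tangent space removes `⟨φ, ∂ᵢ∂ⱼφ⟩ φ / ρ²`, which is `-⟨∂ᵢφ, ∂ⱼφ⟩ φ / ρ²`.
Taking the trace gives the correction `|dφ|² φ / ρ²` to the Laplacian. -/
theorem tension_apply {φ : M → Sph N ρ} (hφ : IsSmooth m φ) (x : M)
    (a : Fin (N + 1)) : tension g φ x a =
      laplacian g (coordFn φ a) x + normSqDifferential g φ x / ρ ^ 2 * coordFn φ a x := by
  have hy := mem_extChartAt_target (I := 𝓡 m) x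
  have hp : localRep φ x (extChartAt (𝓡 m) x x) = φ x := by
    rw [localRep, extChartAt_to_inv]
  have hn : ‖(φ x : EuclideanSpace ℝ (Fin (N + 1)))‖ = ρ := mem_sphere_zero_iff_norm.1 (φ x).2
  have hin : ∀ i j, inner ℝ (φ x : EuclideanSpace ℝ (Fin (N + 1)))
      (partialD i (partialD j (localRep φ x)) (extChartAt (𝓡 m) x x)) =
      - ∑ a, partialD i (chartRep x (coordFn φ a)) (extChartAt (𝓡 m) x x) *
        partialD j (chartRep x (coordFn φ a)) (extChartAt (𝓡 m) x x) := fun i j => by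
    rw [← sum_coordFn_mul_partialD_partialD hφ x hy i j, PiLp.inner_apply]
    refine Finset.sum_congr rfl fun a _ => ?_
    rw [partialD_partialD_localRep_apply hφ x hy]
    simp [chartRep, coordFn, mul_comm]
  have hII : ∀ i j, secondFundForm g φ x (extChartAt (𝓡 m) x x) i j a =
      (partialD i (partialD j (chartRep x (coordFn φ a))) (extChartAt (𝓡 m) x x)
        - ∑ k, christoffel g x (extChartAt (𝓡 m) x x) k i j *
          partialD k (chartRep x (coordFn φ a)) (extChartAt (𝓡 m) x x))
      + (∑ a, partialD i (chartRep x (coordFn φ a)) (extChartAt (𝓡 m) x x) *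
        partialD j (chartRep x (coordFn φ a)) (extChartAt (𝓡 m) x x)) / ρ ^ 2 * coordFn φ a x :=
    fun i j => by
    rw [secondFundForm, PiLp.sub_apply, starProjection_orthogonal_span_singleton_apply, hp, hin, hn,
      partialD_partialD_localRep_apply hφ x hy]
    simp only [WithLp.ofLp_sum, Finset.sum_apply, PiLp.smul_apply, smul_eq_mul,
      partialD_localRep_apply hφ x hy]
    rw [coordFn]
    ring
  have hsum : tension g φ x a = ∑ i, ∑ j, (gram g x (extChartAt (𝓡 m) x x))⁻¹ i j *
      secondFundForm g φ x (extChartAt (𝓡 m) x x) i j a := by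
    simp [tension, Finset.sum_apply]
  rw [hsum, normSqDifferential_eq_sum, laplacian, chartLaplacian]
  simp only [hII, mul_add, Finset.sum_add_distrib]
  congr 1
  rw [Finset.sum_div, Finset.sum_mul]
  refine Finset.sum_congr rfl fun i _ => ?_
  rw [Finset.sum_div, Finset.sum_mul]
  exact Finset.sum_congr rfl fun j _ => by ring

/-- Expand the square of `Δφ + (u/ρ²) φ`, where `u = |dφ|²`: the cross term is `-2u²/ρ²` and the
last term is `u²/ρ²`. -/
theorem norm_tension_sq (hρ : 0 < ρ) {φ : M → Sph N ρ} (hφ : IsSmooth m φ) (x : M) :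
    ‖tension g φ x‖ ^ 2 = ∑ a, laplacian g (coordFn φ a) x * laplacian g (coordFn φ a) x
      - normSqDifferential g φ x * normSqDifferential g φ x / ρ ^ 2 := by
  have h1 := sum_coordFn_mul_laplacian g hφ x
  have h2 := sum_coordFn_sq φ x
  rw [EuclideanSpace.norm_sq_eq]
  have e : ∀ a, ‖tension g φ x a‖ ^ 2 = laplacian g (coordFn φ a) x * laplacian g (coordFn φ a) x
      + 2 * (normSqDifferential g φ x / ρ ^ 2) * (coordFn φ a x * laplacian g (coordFn φ a) x)
      + (normSqDifferential g φ x / ρ ^ 2) ^ 2 * (coordFn φ a x * coordFn φ a x) := fun a => by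
    rw [tension_apply g hφ, Real.norm_eq_abs, sq_abs]
    ring
  simp only [e, Finset.sum_add_distrib, ← Finset.mul_sum, h1, h2]
  field_simp
  ring

end SphereValued

/-! ### Variations and the Euler–Lagrange equations. -/

section FirstVariation

open Topology Set

variable {m : ℕ} {M : Type*} [TopologicalSpace M] [ChartedSpace (EuclideanSpace ℝ (Fin m)) M]
  [IsManifold (𝓡 m) ∞ M] {N : ℕ} {ρ : ℝ}

theorem IsSmoothFamily.sum {ι : Type*} [Fintype ι] {F : ι → ℝ → M → ℝ}
    (hF : ∀ a, IsSmoothFamily m (F a)) : IsSmoothFamily m fun t x => ∑ a, F a t x :=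
  contMDiff_finsetSum fun a _ => hF a

theorem IsSmoothFamily.mul {F H : ℝ → M → ℝ} (hF : IsSmoothFamily m F)
    (hH : IsSmoothFamily m H) : IsSmoothFamily m fun t x => F t x * H t x :=
  ContMDiff.mul hF hH

theorem IsSmoothFamily.sub {F H : ℝ → M → ℝ} (hF : IsSmoothFamily m F)
    (hH : IsSmoothFamily m H) : IsSmoothFamily m fun t x => F t x - H t x :=
  ContMDiff.sub hF hH

theorem IsVariation.coordFn {φ : M → Sph N ρ} {Φ : ℝ → M → Sph N ρ} (hΦ : IsVariation m φ Φ)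
    (a : Fin (N + 1)) : IsSmoothFamily m fun t => coordFn (Φ t) a :=
  contMDiff_coord hΦ.smooth a

theorem IsVariation.isSmooth {φ : M → Sph N ρ} {Φ : ℝ → M → Sph N ρ} (hΦ : IsVariation m φ Φ)
    (t : ℝ) : IsSmooth m (Φ t) :=
  .of_coordFn fun a => (hΦ.coordFn a).slice t

/-- The `a`-th component of the variation vector field of a variation. -/
def variationField (Φ : ℝ → M → Sph N ρ) (a : Fin (N + 1)) : M → ℝ :=
  timeDeriv (fun t => SphereMaps.coordFn (Φ t) a) 0

theorem IsVariation.contMDiff_variationField {φ : M → Sph N ρ} {Φ : ℝ → M → Sph N ρ}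
    (hΦ : IsVariation m φ Φ) (a : Fin (N + 1)) :
    ContMDiff (𝓡 m) 𝓘(ℝ, ℝ) ∞ (variationField Φ a) :=
  (hΦ.coordFn a).timeDeriv.slice 0

theorem IsVariation.sum_coordFn_mul_variationField {φ : M → Sph N ρ} {Φ : ℝ → M → Sph N ρ}
    (hΦ : IsVariation m φ Φ) (x : M) :
    ∑ a, SphereMaps.coordFn φ a x * variationField Φ a x = 0 := by
  have h1 : HasDerivAt (fun t => ∑ a, SphereMaps.coordFn (Φ t) a x * SphereMaps.coordFn (Φ t) a x)
      (∑ a, (variationField Φ a x * SphereMaps.coordFn (Φ 0) a x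
        + SphereMaps.coordFn (Φ 0) a x * variationField Φ a x)) 0 :=
    HasDerivAt.fun_sum fun a _ =>
      ((hΦ.coordFn a).hasDerivAt 0 x).mul ((hΦ.coordFn a).hasDerivAt 0 x)
  simp only [sum_coordFn_sq, hΦ.at_zero] at h1
  have h2 := h1.unique (hasDerivAt_const _ _)
  simp only [mul_comm (variationField _ _ _), ← two_mul, ← Finset.mul_sum] at h2
  simpa using h2

/-- Every smooth vector field along `φ` tangent to the sphere is the variation field of a
variation, namely of the normalised affine variation `ρ (φ + tV) / |φ + tV|`. -/
theorem exists_isVariation (hρ : 0 < ρ) {φ : M → Sph N ρ} (hφ : IsSmooth m φ)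
    {V : Fin (N + 1) → M → ℝ} (hV : ∀ a, ContMDiff (𝓡 m) 𝓘(ℝ, ℝ) ∞ (V a))
    (htan : ∀ x, ∑ a, coordFn φ a x * V a x = 0) :
    ∃ Φ : ℝ → M → Sph N ρ, IsVariation m φ Φ ∧ variationField Φ = V := by
  set w : M → ℝ := fun x => ∑ a, V a x * V a x with hw
  have hw0 : ∀ x, 0 ≤ w x := fun x => Finset.sum_nonneg fun a _ => mul_self_nonneg _
  -- The normalising factor as a function of `s = t²|V|²`: tangency gives `|φ + tV|² = ρ² + t²|V|²`.
  set κ : ℝ → ℝ := fun s => ρ / √(ρ ^ 2 + s) with hκ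
  have hpos : ∀ (t : ℝ) (x : M), 0 < ρ ^ 2 + t ^ 2 * w x := fun t x => by
    have := mul_nonneg (sq_nonneg t) (hw0 x)
    positivity
  have hκs : ∀ s, 0 < ρ ^ 2 + s → ContDiffAt ℝ ∞ κ s := fun s hs =>
    contDiffAt_const.div ((contDiffAt_const.add contDiffAt_id).sqrt hs.ne')
      (Real.sqrt_pos.2 hs).ne'
  have hκ0 : κ 0 = 1 := by
    simp only [hκ, add_zero, Real.sqrt_sq hρ.le]
    exact div_self hρ.ne'
  let f : ℝ → M → EuclideanSpace ℝ (Fin (N + 1)) := fun t x =>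
    WithLp.toLp 2 fun a => κ (t ^ 2 * w x) * (coordFn φ a x + t * V a x)
  have hf : ∀ t x, f t x ∈ Metric.sphere (0 : EuclideanSpace ℝ (Fin (N + 1))) ρ := fun t x => by
    rw [mem_sphere_zero_iff_norm]
    refine (pow_left_inj₀ (norm_nonneg _) hρ.le two_ne_zero).1 ?_
    have e : ∀ a, ‖f t x a‖ ^ 2 = κ (t ^ 2 * w x) ^ 2 * (coordFn φ a x * coordFn φ a x
        + 2 * t * (coordFn φ a x * V a x) + t ^ 2 * (V a x * V a x)) := fun a => by
      rw [Real.norm_eq_abs, sq_abs]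
      simp only [f]
      ring
    rw [EuclideanSpace.norm_sq_eq]
    simp only [e, ← Finset.mul_sum, Finset.sum_add_distrib, sum_coordFn_sq, htan]
    have hwx : ∑ a, V a x * V a x = w x := rfl
    rw [hwx, mul_zero, add_zero]
    simp only [hκ, div_pow, Real.sq_sqrt (hpos t x).le]
    exact div_mul_cancel₀ _ (hpos t x).ne'
  have hcoord : ∀ a, coordFn (fun x => (⟨f 0 x, hf 0 x⟩ : Sph N ρ)) a = coordFn φ a := fun a => by
    funext x
    simp [coordFn, f, hκ0]
  have hsm : ∀ a, IsSmoothFamily m fun t x => f t x a := fun a => by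
    have hwS : ContMDiff (𝓘(ℝ, ℝ).prod (𝓡 m)) 𝓘(ℝ, ℝ) ∞ fun q : ℝ × M => q.1 ^ 2 * w q.2 :=
      (contMDiff_fst.pow 2).mul ((contMDiff_finsetSum fun a _ => (hV a).mul (hV a)).comp
        contMDiff_snd)
    have hκS : ContMDiff (𝓘(ℝ, ℝ).prod (𝓡 m)) 𝓘(ℝ, ℝ) ∞ fun q : ℝ × M => κ (q.1 ^ 2 * w q.2) :=
      fun q => ContMDiffAt.comp (g := κ) q (hκs _ (hpos q.1 q.2)).contMDiffAt (hwS q)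
    exact hκS.mul (((hφ.coordFn a).comp contMDiff_snd).add
      (contMDiff_fst.mul ((hV a).comp contMDiff_snd)))
  refine ⟨fun t x => ⟨f t x, hf t x⟩, ⟨contMDiff_of_coord hsm, ?_⟩, ?_⟩
  · funext x
    refine Subtype.ext ?_
    ext a
    exact congrFun (hcoord a) x
  · funext a x
    refine HasDerivAt.deriv ?_
    -- The parameter enters the normalising factor only through `t²`, so to first order the
    -- normalisation does not change the affine variation.
    have h1 : HasDerivAt (fun t : ℝ => t ^ 2 * w x) 0 0 := by
      simpa using (hasDerivAt_pow 2 (0 : ℝ)).mul_const (w x)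
    have h2 : HasDerivAt (fun t : ℝ => κ (t ^ 2 * w x)) 0 0 := by
      have hd : HasDerivAt κ (deriv κ 0) ((0 : ℝ) ^ 2 * w x) := by
        rw [zero_pow two_ne_zero, zero_mul]
        exact ((hκs 0 (by positivity)).differentiableAt (by simp)).hasDerivAt
      have h := hd.comp (0 : ℝ) h1
      rw [mul_zero] at h
      exact h
    have h3 : HasDerivAt (fun t : ℝ => coordFn φ a x + t * V a x) (V a x) 0 := by
      simpa using ((hasDerivAt_id (0 : ℝ)).mul_const (V a x)).const_add (coordFn φ a x)
    have h4 := h2.mul h3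
    simp only [zero_mul, add_zero, zero_pow two_ne_zero, hκ0, one_mul, zero_add] at h4
    exact h4

variable (g : Metr m M) [CompactSpace M] [T2Space M] [MeasurableSpace M] [BorelSpace M]

/-- Differentiation under the integral sign: the parameter derivative is bounded on the compact set
`[t - 1, t + 1] × M`, and the volume is finite. -/
theorem IsSmoothFamily.hasDerivAt_integral {F : ℝ → M → ℝ} (hF : IsSmoothFamily m F) (t : ℝ) :
    HasDerivAt (fun s => ∫ x, F s x ∂(vol g)) (∫ x, SphereMaps.timeDeriv F t x ∂(vol g)) t := by
  obtain ⟨C, hC⟩ := ((isCompact_closedBall t 1).prod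
    (isCompact_univ (X := M))).exists_bound_of_continuousOn hF.timeDeriv.continuous.continuousOn
  refine (hasDerivAt_integral_of_dominated_loc_of_deriv_le (bound := fun _ => C)
    (Metric.closedBall_mem_nhds t one_pos)
    (Filter.Eventually.of_forall fun s => (hF.slice s).continuous.aestronglyMeasurable)
    (integrable_of_continuous (hF.slice t).continuous)
    (hF.timeDeriv.slice t).continuous.aestronglyMeasurable
    (Filter.Eventually.of_forall fun x s hs => hC (s, x) ⟨hs, mem_univ x⟩)
    (integrable_const C)
    (Filter.Eventually.of_forall fun x s _ => hF.hasDerivAt s x)).2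

theorem energy_eq {φ : M → Sph N ρ} (hφ : IsSmooth m φ) :
    energy g φ = ∫ x, (1 / 2) * normSqDifferential g φ x ∂(vol g) := by
  simp only [energy, energyDensity_eq g hφ]

theorem bienergy_eq (hρ : 0 < ρ) {φ : M → Sph N ρ} (hφ : IsSmooth m φ) :
    bienergy g φ = ∫ x, (1 / 2) * (∑ a, laplacian g (coordFn φ a) x * laplacian g (coordFn φ a) x
      - normSqDifferential g φ x * normSqDifferential g φ x / ρ ^ 2) ∂(vol g) := by
  simp only [bienergy, norm_tension_sq g hρ hφ, integral_const_mul]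

theorem IsVariation.isSmoothFamily_normSqDifferential {φ : M → Sph N ρ} {Φ : ℝ → M → Sph N ρ}
    (hΦ : IsVariation m φ Φ) : IsSmoothFamily m fun t => normSqDifferential g (Φ t) :=
  .sum fun a => (hΦ.coordFn a).gradInner g (hΦ.coordFn a)

theorem IsVariation.hasDerivAt_normSqDifferential {φ : M → Sph N ρ} {Φ : ℝ → M → Sph N ρ}
    (hΦ : IsVariation m φ Φ) (x : M) :
    HasDerivAt (fun t => normSqDifferential g (Φ t) x)
      (2 * ∑ a, gradInner g (SphereMaps.coordFn φ a) (variationField Φ a) x) 0 := by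
  have h := HasDerivAt.fun_sum (u := Finset.univ) fun a _ =>
    (hΦ.coordFn a).hasDerivAt_gradInner g (hΦ.coordFn a) 0 x
  refine h.congr_deriv ?_
  rw [Finset.mul_sum]
  refine Finset.sum_congr rfl fun a _ => ?_
  rw [hΦ.at_zero, two_mul, variationField]
  congr 1
  exact gradInner_comm g _ _ x

/-- The first variation of the energy. -/
theorem IsVariation.hasDerivAt_energy {φ : M → Sph N ρ} {Φ : ℝ → M → Sph N ρ}
    (hΦ : IsVariation m φ Φ) :
    HasDerivAt (fun t => energy g (Φ t))
      (∫ x, ∑ a, gradInner g (SphereMaps.coordFn φ a) (variationField Φ a) x ∂(vol g)) 0 := by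
  have hs : IsSmoothFamily m fun t x => (1 / 2) * normSqDifferential g (Φ t) x :=
    IsSmoothFamily.mul contMDiff_const (hΦ.isSmoothFamily_normSqDifferential g)
  have h := hs.hasDerivAt_integral g 0
  simp only [← energy_eq g (hΦ.isSmooth _)] at h
  convert h using 2
  funext x
  refine Eq.symm (HasDerivAt.deriv ?_)
  refine ((hΦ.hasDerivAt_normSqDifferential g x).const_mul (1 / 2)).congr_deriv ?_
  ring

/-- The first variation of the bienergy. -/
theorem IsVariation.hasDerivAt_bienergy (hρ : 0 < ρ) {φ : M → Sph N ρ} {Φ : ℝ → M → Sph N ρ}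
    (hΦ : IsVariation m φ Φ) :
    HasDerivAt (fun t => bienergy g (Φ t))
      (∫ x, (∑ a, laplacian g (SphereMaps.coordFn φ a) x * laplacian g (variationField Φ a) x
        - 2 / ρ ^ 2 * (normSqDifferential g φ x *
          ∑ a, gradInner g (SphereMaps.coordFn φ a) (variationField Φ a) x)) ∂(vol g)) 0 := by
  have hu := hΦ.isSmoothFamily_normSqDifferential g
  have hs : IsSmoothFamily m fun t x => (1 / 2) * (∑ a,
      laplacian g (SphereMaps.coordFn (Φ t) a) x * laplacian g (SphereMaps.coordFn (Φ t) a) x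
      - normSqDifferential g (Φ t) x * normSqDifferential g (Φ t) x * (ρ ^ 2)⁻¹) :=
    IsSmoothFamily.mul contMDiff_const ((IsSmoothFamily.sum fun a =>
      ((hΦ.coordFn a).laplacian g).mul ((hΦ.coordFn a).laplacian g)).sub
        ((hu.mul hu).mul contMDiff_const))
  have h := hs.hasDerivAt_integral g 0
  simp only [← div_eq_mul_inv, ← bienergy_eq g hρ (hΦ.isSmooth _)] at h
  convert h using 2
  funext x
  refine Eq.symm (HasDerivAt.deriv ?_)
  have h1 := HasDerivAt.fun_sum (u := Finset.univ) fun a _ =>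
    ((hΦ.coordFn a).hasDerivAt_laplacian g 0 x).mul ((hΦ.coordFn a).hasDerivAt_laplacian g 0 x)
  have hn := hΦ.hasDerivAt_normSqDifferential g x
  have h2 := (h1.sub ((hn.mul hn).div_const (ρ ^ 2))).const_mul (1 / 2)
  refine h2.congr_deriv ?_
  have hv : ∀ a, timeDeriv (fun t => SphereMaps.coordFn (Φ t) a) 0 = variationField Φ a :=
    fun _ => rfl
  simp only [hΦ.at_zero, hv]
  simp only [mul_comm (laplacian g (variationField Φ _) x), ← two_mul, ← Finset.mul_sum]
  ring

theorem integral_sum_gradInner {k : ℕ} {f h : Fin k → M → ℝ}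
    (hf : ∀ a, ContMDiff (𝓡 m) 𝓘(ℝ, ℝ) ∞ (f a)) (hh : ∀ a, ContMDiff (𝓡 m) 𝓘(ℝ, ℝ) ∞ (h a)) :
    ∫ x, ∑ a, gradInner g (f a) (h a) x ∂(vol g) =
      - ∫ x, ∑ a, h a x * laplacian g (f a) x ∂(vol g) := by
  have h1 : ∀ a, Integrable (fun x => h a x * laplacian g (f a) x) (vol g) := fun a =>
    integrable_of_continuous ((hh a).continuous.mul (contMDiff_laplacian g (hf a)).continuous)
  rw [integral_finsetSum _ fun a _ =>
      integrable_of_continuous (contMDiff_gradInner g (hf a) (hh a)).continuous,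
    integral_finsetSum _ fun a _ => h1 a, ← Finset.sum_neg_distrib]
  exact Finset.sum_congr rfl fun a _ => by rw [integral_mul_laplacian g (hf a) (hh a), neg_neg]

theorem eq_zero_of_integral_eq_zero {F : M → ℝ} (hF : Continuous F) (h0 : ∀ x, 0 ≤ F x)
    (h : ∫ x, F x ∂(vol g) = 0) (x : M) : F x = 0 :=
  congrFun ((Continuous.ae_eq_iff_eq (vol g) hF continuous_const).1
    ((integral_eq_zero_iff_of_nonneg h0 (integrable_of_continuous hF)).1 h)) x

/-- A map into a sphere is harmonic if and only if its tension field vanishes. -/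
theorem isHarmonic_iff (hρ : 0 < ρ) {φ : M → Sph N ρ} (hφ : IsSmooth m φ) :
    IsHarmonic g φ ↔ ∀ a x, laplacian g (coordFn φ a) x =
      - (normSqDifferential g φ x / ρ ^ 2 * coordFn φ a x) := by
  constructor
  · rintro ⟨-, h⟩ a x
    -- The test field is the tension field itself.
    set V : Fin (N + 1) → M → ℝ := fun a x => laplacian g (coordFn φ a) x
      + normSqDifferential g φ x * (ρ ^ 2)⁻¹ * coordFn φ a x with hVdef
    have hV : ∀ a, ContMDiff (𝓡 m) 𝓘(ℝ, ℝ) ∞ (V a) := fun a =>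
      (contMDiff_laplacian g (hφ.coordFn a)).add
        (((contMDiff_normSqDifferential g hφ).mul contMDiff_const).mul (hφ.coordFn a))
    have htan : ∀ x, ∑ a, coordFn φ a x * V a x = 0 := fun x => by
      have e : ∀ a, coordFn φ a x * V a x = coordFn φ a x * laplacian g (coordFn φ a) x
          + normSqDifferential g φ x * (ρ ^ 2)⁻¹ * (coordFn φ a x * coordFn φ a x) := fun a => by
        simp only [hVdef]
        ring
      simp only [e, Finset.sum_add_distrib, ← Finset.mul_sum, sum_coordFn_mul_laplacian g hφ,
        sum_coordFn_sq]
      field_simp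
      ring
    obtain ⟨Φ, hΦ, hΦV⟩ := exists_isVariation hρ hφ hV htan
    have h1 := (h Φ hΦ).unique (hΦ.hasDerivAt_energy g)
    rw [hΦV, integral_sum_gradInner g (fun a => hφ.coordFn a) hV, zero_eq_neg] at h1
    -- `V` and `Δφ` differ by a multiple of `φ`, to which `V` is orthogonal. The first variation is
    -- thus `-∫ |V|²`.
    have e : ∀ x, ∑ a, V a x * laplacian g (coordFn φ a) x = ∑ a, V a x * V a x := fun x => by
      have e1 : ∀ a, V a x * V a x = V a x * laplacian g (coordFn φ a) x
          + normSqDifferential g φ x * (ρ ^ 2)⁻¹ * (coordFn φ a x * V a x) := fun a => by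
        simp only [hVdef]
        ring
      simp only [e1, Finset.sum_add_distrib, ← Finset.mul_sum, htan, mul_zero, add_zero]
    simp only [e] at h1
    have h2 := eq_zero_of_integral_eq_zero g
      (continuous_finsetSum _ fun a _ => (hV a).continuous.mul (hV a).continuous)
      (fun x => Finset.sum_nonneg fun a _ => mul_self_nonneg _) h1 x
    have h3 := (Finset.sum_eq_zero_iff_of_nonneg fun a _ => mul_self_nonneg (V a x)).1 h2 a
      (Finset.mem_univ a)
    have h4 : V a x = 0 := mul_self_eq_zero.1 h3
    rw [div_eq_mul_inv]
    exact eq_neg_of_add_eq_zero_left h4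
  · intro h
    refine ⟨hφ, fun Φ hΦ => ?_⟩
    have h1 := hΦ.hasDerivAt_energy g
    rw [integral_sum_gradInner g (fun a => hφ.coordFn a) hΦ.contMDiff_variationField] at h1
    have e : ∀ x, ∑ a, variationField Φ a x * laplacian g (coordFn φ a) x = 0 := fun x => by
      have e1 : ∀ a, variationField Φ a x * laplacian g (coordFn φ a) x =
          - (normSqDifferential g φ x / ρ ^ 2) * (coordFn φ a x * variationField Φ a x) :=
        fun a => by
          rw [h]
          ring
      simp only [e1, ← Finset.mul_sum, hΦ.sum_coordFn_mul_variationField, mul_zero]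
    simpa [e] using h1

/-- The first variation depends only on the variation field, and these fields are exactly the smooth
tangent ones. The weak form is kept: no fourth-order equation is derived. -/
theorem isBiharmonic_iff (hρ : 0 < ρ) {φ : M → Sph N ρ} (hφ : IsSmooth m φ) :
    IsBiharmonic g φ ↔ ∀ V : Fin (N + 1) → M → ℝ, (∀ a, ContMDiff (𝓡 m) 𝓘(ℝ, ℝ) ∞ (V a)) →
      (∀ x, ∑ a, coordFn φ a x * V a x = 0) →
      ∫ x, (∑ a, laplacian g (coordFn φ a) x * laplacian g (V a) x
        - 2 / ρ ^ 2 * (normSqDifferential g φ x *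
          ∑ a, gradInner g (coordFn φ a) (V a) x)) ∂(vol g) = 0 := by
  constructor
  · rintro ⟨-, h⟩ V hV htan
    obtain ⟨Φ, hΦ, rfl⟩ := exists_isVariation hρ hφ hV htan
    exact (hΦ.hasDerivAt_bienergy g hρ).unique (h Φ hΦ)
  · intro h
    refine ⟨hφ, fun Φ hΦ => ?_⟩
    have h1 := hΦ.hasDerivAt_bienergy g hρ
    rwa [h _ hΦ.contMDiff_variationField hΦ.sum_coordFn_mul_variationField] at h1

end FirstVariation

/-! ### Composition with the small hypersphere. -/

section SmallHypersphere

variable {m n : ℕ} {M : Type*} [TopologicalSpace M] [ChartedSpace (EuclideanSpace ℝ (Fin m)) M]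
  {r : ℝ}

theorem coordFn_smallInclusion_castSucc (hr : 0 < r) (ψ : M → Sph n (r / √2)) (a : Fin (n + 1)) :
    coordFn (smallInclusion n hr ∘ ψ) a.castSucc = coordFn ψ a := by
  funext x
  simp [coordFn, smallInclusion, appendHeight]

theorem coordFn_smallInclusion_last (hr : 0 < r) (ψ : M → Sph n (r / √2)) :
    coordFn (smallInclusion n hr ∘ ψ) (Fin.last (n + 1)) = fun _ => r / √2 := by
  funext x
  simp [coordFn, smallInclusion, appendHeight]

theorem div_sqrt_two_sq (r : ℝ) : (r / √2) ^ 2 = r ^ 2 / 2 := by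
  rw [div_pow, Real.sq_sqrt (by norm_num)]

variable [IsManifold (𝓡 m) ∞ M]

theorem IsSmooth.smallInclusion_comp (hr : 0 < r) {ψ : M → Sph n (r / √2)} (hψ : IsSmooth m ψ) :
    IsSmooth m (smallInclusion n hr ∘ ψ) := by
  refine .of_coordFn fun a => ?_
  induction a using Fin.lastCases with
  | last => rw [coordFn_smallInclusion_last]; exact contMDiff_const
  | cast a => rw [coordFn_smallInclusion_castSucc]; exact hψ.coordFn a

variable (g : Metr m M)

theorem gradInner_const_left (a : ℝ) (h : M → ℝ) (x : M) : gradInner g (fun _ => a) h x = 0 := by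
  rw [gradInner_comm, gradInner_const_right]

theorem normSqDifferential_smallInclusion_comp (hr : 0 < r) (ψ : M → Sph n (r / √2)) (x : M) :
    normSqDifferential g (smallInclusion n hr ∘ ψ) x = normSqDifferential g ψ x := by
  rw [normSqDifferential, Fin.sum_univ_castSucc, coordFn_smallInclusion_last,
    gradInner_const_right, add_zero]
  simp only [coordFn_smallInclusion_castSucc, normSqDifferential]

theorem eq_of_normSqDifferential_eq_zero [PreconnectedSpace M] {N : ℕ} {ρ : ℝ} {φ : M → Sph N ρ}
    (hφ : IsSmooth m φ) (h : ∀ x, normSqDifferential g φ x = 0) (x y : M) : φ x = φ y := by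
  refine Subtype.ext ?_
  ext a
  exact eq_of_gradInner_self_eq_zero g (hφ.coordFn a) (fun z =>
    (Finset.sum_eq_zero_iff_of_nonneg fun b _ => gradInner_self_nonneg g _ z).1 (h z) a
      (Finset.mem_univ a)) x y

variable [CompactSpace M] [T2Space M] [MeasurableSpace M] [BorelSpace M]

/-- The composition of a nonconstant map with the inclusion of the small hypersphere is never
harmonic. -/
theorem not_isHarmonic_smallInclusion_comp [ConnectedSpace M] (hr : 0 < r)
    {ψ : M → Sph n (r / √2)} (hψ : IsSmooth m ψ) (hne : ¬ ∃ p, ∀ x, ψ x = p) :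
    ¬ IsHarmonic g (smallInclusion n hr ∘ ψ) := by
  intro h
  rw [isHarmonic_iff g hr (hψ.smallInclusion_comp hr)] at h
  have hz : ∀ x, normSqDifferential g ψ x = 0 := fun x => by
    -- The last coordinate is a nonzero constant, so its Laplacian vanishes and its component of the
    -- harmonic map equation reads `|dψ|² = 0`.
    have h1 := h (Fin.last (n + 1)) x
    rw [coordFn_smallInclusion_last, laplacian_const, normSqDifferential_smallInclusion_comp,
      zero_eq_neg] at h1
    have hpos : r / √2 ≠ 0 := by positivity
    have h2 := (mul_eq_zero.1 h1).resolve_right hpos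
    exact (div_eq_zero_iff.1 h2).resolve_right (by positivity)
  obtain ⟨x0⟩ := (inferInstance : Nonempty M)
  exact hne ⟨ψ x0, fun x => eq_of_normSqDifferential_eq_zero g hψ hz x x0⟩

/-- The constant last coordinate drops out of the integrand, so the last component of a tangent
field serves only to satisfy tangency. As that coordinate is nonzero, any `W` extends to a tangent
field, and the constraint disappears. -/
theorem isBiharmonic_smallInclusion_comp_iff (hr : 0 < r) {ψ : M → Sph n (r / √2)}
    (hψ : IsSmooth m ψ) : IsBiharmonic g (smallInclusion n hr ∘ ψ) ↔
      ∀ W : Fin (n + 1) → M → ℝ, (∀ a, ContMDiff (𝓡 m) 𝓘(ℝ, ℝ) ∞ (W a)) →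
        ∫ x, (∑ a, laplacian g (coordFn ψ a) x * laplacian g (W a) x
          - 2 / r ^ 2 * (normSqDifferential g ψ x *
            ∑ a, gradInner g (coordFn ψ a) (W a) x)) ∂(vol g) = 0 := by
  have hh : r / √2 ≠ 0 := by positivity
  rw [isBiharmonic_iff g hr (hψ.smallInclusion_comp hr)]
  simp only [Fin.sum_univ_castSucc (n := n + 1), coordFn_smallInclusion_castSucc,
    coordFn_smallInclusion_last, laplacian_const, gradInner_const_left, zero_mul, add_zero,
    normSqDifferential_smallInclusion_comp]
  constructor
  · intro h W hW
    -- The last component solves `⟨ψ, W⟩ + (r/√2) V_last = 0`.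
    let V : Fin (n + 1 + 1) → M → ℝ := Fin.snoc (α := fun _ => M → ℝ) W
      fun x => - ((r / √2)⁻¹ * ∑ a, coordFn ψ a x * W a x)
    have hc : ∀ a : Fin (n + 1), V a.castSucc = W a := fun a => Fin.snoc_castSucc _ _ _
    have hl : V (Fin.last (n + 1)) = fun x => - ((r / √2)⁻¹ * ∑ a, coordFn ψ a x * W a x) :=
      Fin.snoc_last _ _
    have h1 := h V (fun a => by
      induction a using Fin.lastCases with
      | last =>
        rw [hl]
        exact (contMDiff_const.mul (contMDiff_finsetSum fun a _ => (hψ.coordFn a).mul (hW a))).neg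
      | cast a => rw [hc]; exact hW a) (fun x => by
        simp only [hc, hl]
        rw [mul_neg, mul_inv_cancel_left₀ hh, add_neg_cancel])
    simpa only [hc] using h1
  · intro h V hV _
    exact h (fun a => V a.castSucc) fun a => hV _

/-- With constant `|dψ|²` and constant eigenvalue, the integrand is `-(2c/r²)` times `⟨ψ, ΔW⟩ + ⟨dW,
dψ⟩`, whose integral vanishes by Green's formula. -/
theorem isBiharmonic_smallInclusion_comp_of_laplacian (hr : 0 < r) {ψ : M → Sph n (r / √2)}
    (hψ : IsSmooth m ψ) {c : ℝ} (hc : ∀ x, normSqDifferential g ψ x = c)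
    (hL : ∀ a x, laplacian g (coordFn ψ a) x = - (2 * c / r ^ 2 * coordFn ψ a x)) :
    IsBiharmonic g (smallInclusion n hr ∘ ψ) := by
  rw [isBiharmonic_smallInclusion_comp_iff g hr hψ]
  intro W hW
  have h1 := integral_sum_gradInner g hW fun a => hψ.coordFn a
  have i1 : Integrable (fun x => ∑ a, coordFn ψ a x * laplacian g (W a) x) (vol g) :=
    integrable_of_continuous (continuous_finsetSum _ fun a _ =>
      (hψ.coordFn a).continuous.mul (contMDiff_laplacian g (hW a)).continuous)
  have i2 : Integrable (fun x => ∑ a, gradInner g (W a) (coordFn ψ a) x) (vol g) :=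
    integrable_of_continuous (continuous_finsetSum _ fun a _ =>
      (contMDiff_gradInner g (hW a) (hψ.coordFn a)).continuous)
  have e : ∀ x, (∑ a, laplacian g (coordFn ψ a) x * laplacian g (W a) x
      - 2 / r ^ 2 * (normSqDifferential g ψ x * ∑ a, gradInner g (coordFn ψ a) (W a) x))
      = - (2 * c / r ^ 2) * (∑ a, coordFn ψ a x * laplacian g (W a) x
        + ∑ a, gradInner g (W a) (coordFn ψ a) x) := fun x => by
    simp only [hL, hc, gradInner_comm g (W _), mul_add, Finset.mul_sum, ← Finset.sum_add_distrib,
      ← Finset.sum_sub_distrib]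
    exact Finset.sum_congr rfl fun a _ => by ring
  simp only [e]
  rw [integral_const_mul, integral_add i1 i2, h1, add_neg_cancel, mul_zero]

/-- Test with `W = ψ`, a field normal to the small sphere. Since `⟨ψ, Δψ⟩ = -u` and `|ψ|² = r²/2`,
where `u = |dψ|²`, the integrand `|Δψ|² - (2/r²) u²` is the perfect square `|Δψ + (2/r²) u ψ|²`. -/
theorem laplacian_coordFn_of_isBiharmonic (hr : 0 < r) {ψ : M → Sph n (r / √2)}
    (hψ : IsSmooth m ψ) (h : IsBiharmonic g (smallInclusion n hr ∘ ψ)) (a : Fin (n + 1)) (x : M) :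
    laplacian g (coordFn ψ a) x = - (2 / r ^ 2 * (normSqDifferential g ψ x * coordFn ψ a x)) := by
  rw [isBiharmonic_smallInclusion_comp_iff g hr hψ] at h
  have hu := contMDiff_normSqDifferential g hψ
  set T : Fin (n + 1) → M → ℝ := fun a x => laplacian g (coordFn ψ a) x
    + 2 / r ^ 2 * (normSqDifferential g ψ x * coordFn ψ a x) with hT
  have hTs : ∀ a, ContMDiff (𝓡 m) 𝓘(ℝ, ℝ) ∞ (T a) := fun a =>
    (contMDiff_laplacian g (hψ.coordFn a)).add
      (contMDiff_const.mul (hu.mul (hψ.coordFn a)))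
  have e : ∀ x, (∑ a, laplacian g (coordFn ψ a) x * laplacian g (coordFn ψ a) x
      - 2 / r ^ 2 * (normSqDifferential g ψ x * ∑ a, gradInner g (coordFn ψ a) (coordFn ψ a) x))
      = ∑ a, T a x * T a x := fun x => by
    have e1 : ∀ a, T a x * T a x = laplacian g (coordFn ψ a) x * laplacian g (coordFn ψ a) x
        + 4 / r ^ 2 * normSqDifferential g ψ x * (coordFn ψ a x * laplacian g (coordFn ψ a) x)
        + 4 / r ^ 4 * normSqDifferential g ψ x ^ 2 * (coordFn ψ a x * coordFn ψ a x) :=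
      fun a => by
        simp only [hT]
        ring
    have e2 : ∑ a, gradInner g (coordFn ψ a) (coordFn ψ a) x = normSqDifferential g ψ x := rfl
    simp only [e1, Finset.sum_add_distrib, ← Finset.mul_sum, sum_coordFn_mul_laplacian g hψ,
      sum_coordFn_sq, div_sqrt_two_sq, e2]
    field_simp
    ring
  have h1 := h (coordFn ψ) fun a => hψ.coordFn a
  simp only [e] at h1
  have h2 := eq_zero_of_integral_eq_zero g
    (continuous_finsetSum _ fun a _ => (hTs a).continuous.mul (hTs a).continuous)
    (fun x => Finset.sum_nonneg fun a _ => mul_self_nonneg _) h1 x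
  have h3 := (Finset.sum_eq_zero_iff_of_nonneg fun a _ => mul_self_nonneg (T a x)).1 h2 a
    (Finset.mem_univ a)
  exact eq_neg_of_add_eq_zero_left (mul_self_eq_zero.1 h3)

/-- Half the derivative of the constant `|φ|²` along the gradient of `f`. -/
theorem sum_coordFn_mul_gradInner {N : ℕ} {ρ : ℝ} {φ : M → Sph N ρ} (hφ : IsSmooth m φ)
    (f : M → ℝ) (x : M) : ∑ a, coordFn φ a x * gradInner g f (coordFn φ a) x = 0 := by
  have h1 := gradInner_sum_right g Finset.univ f (h := fun a z => coordFn φ a z * coordFn φ a z)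
    (fun a => (hφ.coordFn a).mul (hφ.coordFn a)) x
  have h2 : ∀ a, gradInner g f (fun z => coordFn φ a z * coordFn φ a z) x
      = 2 * (coordFn φ a x * gradInner g f (coordFn φ a) x) := fun a => by
    rw [gradInner_mul_right g f (hφ.coordFn a) (hφ.coordFn a) x]
    ring
  simp only [sum_coordFn_sq, gradInner_const_right, h2, ← Finset.mul_sum] at h1
  linarith

/-- Test with `W = u ψ`, where `u = |dψ|²`. The weak equation and Green's formula give `∫ |dW|² = ∫
u ⟨dψ, dW⟩`, whereas pointwise the two integrands differ by `(r²/2)|du|²`. -/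
theorem gradInner_normSqDifferential_self_of_isBiharmonic (hr : 0 < r) {ψ : M → Sph n (r / √2)}
    (hψ : IsSmooth m ψ) (h : IsBiharmonic g (smallInclusion n hr ∘ ψ)) (x : M) :
    gradInner g (normSqDifferential g ψ) (normSqDifferential g ψ) x = 0 := by
  have hL := laplacian_coordFn_of_isBiharmonic g hr hψ h
  rw [isBiharmonic_smallInclusion_comp_iff g hr hψ] at h
  set u := normSqDifferential g ψ with hudef
  have hu : ContMDiff (𝓡 m) 𝓘(ℝ, ℝ) ∞ u := contMDiff_normSqDifferential g hψ
  set W : Fin (n + 1) → M → ℝ := fun a x => u x * coordFn ψ a x with hWdef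
  have hW : ∀ a, ContMDiff (𝓡 m) 𝓘(ℝ, ℝ) ∞ (W a) := fun a => hu.mul (hψ.coordFn a)
  have h1 := h W hW
  have h2 := integral_sum_gradInner g hW hW
  have i1 : Integrable (fun x => ∑ a, W a x * laplacian g (W a) x) (vol g) :=
    integrable_of_continuous (continuous_finsetSum _ fun a _ =>
      (hW a).continuous.mul (contMDiff_laplacian g (hW a)).continuous)
  have i2 : Integrable (fun x => u x * ∑ a, gradInner g (coordFn ψ a) (W a) x) (vol g) :=
    integrable_of_continuous (hu.continuous.mul (continuous_finsetSum _ fun a _ =>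
      (contMDiff_gradInner g (hψ.coordFn a) (hW a)).continuous))
  have i3 : Integrable (fun x => ∑ a, gradInner g (W a) (W a) x) (vol g) :=
    integrable_of_continuous (continuous_finsetSum _ fun a _ =>
      (contMDiff_gradInner g (hW a) (hW a)).continuous)
  -- The equation already obtained for `ψ` reads `Δψ = -(2/r²) W`, which makes `-(2/r²)` a common
  -- factor.
  have e : ∀ x, (∑ a, laplacian g (coordFn ψ a) x * laplacian g (W a) x
      - 2 / r ^ 2 * (u x * ∑ a, gradInner g (coordFn ψ a) (W a) x))
      = - (2 / r ^ 2) * (∑ a, W a x * laplacian g (W a) x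
        + u x * ∑ a, gradInner g (coordFn ψ a) (W a) x) := fun x => by
    have : ∀ a, laplacian g (coordFn ψ a) x * laplacian g (W a) x
        = - (2 / r ^ 2) * (W a x * laplacian g (W a) x) := fun a => by
      rw [hL a x]
      simp only [hWdef]
      ring
    simp only [this, ← Finset.mul_sum]
    ring
  simp only [e] at h1
  rw [integral_const_mul, integral_add i1 i2] at h1
  have h3 := (mul_eq_zero.1 h1).resolve_left (by simp [hr.ne'])
  -- Expand one factor as `dW = u dψ + ψ du`. In `⟨ψ du, dW⟩` the term with `dψ` vanishes because
  -- `ψ` is orthogonal to its derivatives, leaving `|ψ|² |du|²`.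
  have e2 : ∀ x, ∑ a, gradInner g (W a) (W a) x
      = u x * ∑ a, gradInner g (coordFn ψ a) (W a) x + r ^ 2 / 2 * gradInner g u u x := fun x => by
    have s1 := sum_coordFn_mul_gradInner g hψ u x
    have s2 := sum_coordFn_sq ψ x
    rw [div_sqrt_two_sq] at s2
    have t1 : ∀ a, gradInner g (W a) (W a) x = u x * gradInner g (coordFn ψ a) (W a) x
        + (u x * (coordFn ψ a x * gradInner g u (coordFn ψ a) x)
          + gradInner g u u x * (coordFn ψ a x * coordFn ψ a x)) := fun a => by
      have b1 := gradInner_mul_right g (W a) hu (hψ.coordFn a) x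
      have b2 := gradInner_mul_right g u hu (hψ.coordFn a) x
      have b3 := gradInner_comm g (W a) u x
      have b4 := gradInner_comm g (W a) (coordFn ψ a) x
      change gradInner g (W a) (W a) x = _ at b1
      change gradInner g u (W a) x = _ at b2
      rw [b1, b3, b4, b2]
      ring
    simp only [t1, Finset.sum_add_distrib, ← Finset.mul_sum, s1, s2]
    ring
  simp only [e2] at h2 i3
  have i4 : Integrable (fun x => r ^ 2 / 2 * gradInner g u u x) (vol g) :=
    integrable_of_continuous (continuous_const.mul (contMDiff_gradInner g hu hu).continuous)
  rw [integral_add i2 i4, integral_const_mul] at h2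
  have h4 : r ^ 2 / 2 * ∫ x, gradInner g u u x ∂(vol g) = 0 := by linarith
  have h5 := (mul_eq_zero.1 h4).resolve_left (by positivity)
  exact eq_zero_of_integral_eq_zero g (contMDiff_gradInner g hu hu).continuous
    (gradInner_self_nonneg g u) h5 x

end SmallHypersphere

end SphereMaps

end

theorem theorem1p1 {m n : ℕ} {M : Type*} [TopologicalSpace M] [T2Space M] [CompactSpace M]
    [ConnectedSpace M] [ChartedSpace (EuclideanSpace ℝ (Fin m)) M] [IsManifold (𝓡 m) ∞ M]
    [MeasurableSpace M] [BorelSpace M] (g : SphereMaps.Metr m M) {r : ℝ} (hr : 0 < r)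
    (ψ : M → SphereMaps.Sph n (r / √2)) (hψ : SphereMaps.IsSmooth m ψ)
    (hne : ¬ ∃ p, ∀ x, ψ x = p) :
    (SphereMaps.IsBiharmonic g (SphereMaps.smallInclusion n hr ∘ ψ) ∧
        ¬ SphereMaps.IsHarmonic g (SphereMaps.smallInclusion n hr ∘ ψ)) ↔
      (SphereMaps.IsHarmonic g ψ ∧ ∃ a : ℝ, ∀ x, SphereMaps.energyDensity g ψ x = a) := by
  have hρ : 0 < r / √2 := by positivity
  simp only [SphereMaps.energyDensity_eq g hψ]
  rw [SphereMaps.isHarmonic_iff g hρ hψ, SphereMaps.div_sqrt_two_sq]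
  constructor
  · rintro ⟨hb, -⟩
    refine ⟨fun a x => ?_, ?_⟩
    · rw [SphereMaps.laplacian_coordFn_of_isBiharmonic g hr hψ hb]
      -- The factor `2/r²` is the inverse square of the radius `r/√2`, so this is the harmonic map
      -- equation of `ψ` into its own sphere.
      field_simp
    · obtain ⟨x0⟩ := (inferInstance : Nonempty M)
      refine ⟨1 / 2 * SphereMaps.normSqDifferential g ψ x0, fun x => ?_⟩
      rw [SphereMaps.eq_of_gradInner_self_eq_zero g
        (SphereMaps.contMDiff_normSqDifferential g hψ)
        (SphereMaps.gradInner_normSqDifferential_self_of_isBiharmonic g hr hψ hb) x x0]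
  · rintro ⟨hL, a, ha⟩
    -- The constant refers to `|dψ|²`, which is twice the energy density.
    refine ⟨SphereMaps.isBiharmonic_smallInclusion_comp_of_laplacian g hr hψ (c := 2 * a)
      (fun x => by linarith [ha x]) fun b x => ?_,
      SphereMaps.not_isHarmonic_smallInclusion_comp g hr hψ hne⟩
    rw [hL, ← ha x]
    field_simp
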